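/- **Theorem 1.** Fix $s>1/2$ and $E_{\max},h_0,\varepsilon_0>0$. For each $h\in(0,h_0]$ let real coefficients $\alpha,\beta,b=b_0+b_1$ and $V=V_0+V_1$ on $\mathbb{R}$ be given (all may depend on $h$) such that: $V_0$ is a finite signed Borel measure; $b_0\in L^1(\mathbb{R})\cap L^2(\mathbb{R})$; $V_1,b_1,\alpha,\beta$ have bounded variation on $\mathbb{R}$; and $\alpha,\beta>0$ with $\inf\alpha,\inf\beta>0$. With $D_x=-i\partial_x$, let $$P(h)=\beta\bigl(-h^2\partial_x(\alpha\,\partial_x)+hbD_x+hD_xb\bigr)+V$$ be the operator with domain $$\mathcal D=\{v\in H^1(\mathbb{R}): h\alpha v'+ibv\in L^\infty \text{ has locally bounded variation and } \beta\, d(-h^2\alpha v'-ihbv)+h\beta bD_xv+v_cV\in L^2(\mathbb{R})\},$$ where $v_c$ is the continuous representative of $v$, $df$ is the (locally finite, complex) derivative measure of a function $f$ of locally bounded variation, and $P(h)v:=\beta\, d(-h^2\alpha v'-ihbv)+h\beta bD_xv+v_cV$ for $v\in\mathcal D$. For each $h\in(0,h_0]$ let $R_1(h)\ge0$, $k(h)\ge0$,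 $\tau(h)>0$, and let $\varphi=\varphi(\cdot,h):\mathbb{R}\to[0,\infty)$ be continuous, even, $C^\infty$ on $(0,\infty)$, with $\varphi(0)=0$, $\varphi'(x)=k(h)$ for $0<x\le R_1(h)$ and $\varphi'(x)=0$ for $x>2R_1(h)$. Then for each $h\in(0,h_0]$ there is a constant $C(h)>0$, depending only on $s,E_{\max},h_0,\varepsilon_0,h$, the coefficients, $R_1(h)$, $k(h)$, $\varphi(\cdot,h)$ and $\tau(h)$, such that the following holds. Let $E\in[-E_{\max},E_{\max}]$ satisfy $$\inf_{|x|\ge R_1(h)}\bigl(\beta^{-1}\alpha(E-V_1)+b_1^2\bigr)>0\qquad\text{and}\qquad \inf_{x\ne0}\bigl(\beta^{-1}\alpha(E-V_1)+\alpha^2(\varphi')^2+b_1^2\bigr)\ge\tau(h),$$ and let $\varepsilon\in[-\varepsilon_0,\varepsilon_0]$. Then for every $v\in\mathcal D$ with $\langle x\rangle^{s}(P(h)-E-i\varepsilon)v\in L^2(\mathbb{R})$, the function $e^{\varphi/h}v$ is weakly differentiable, the left-hand integrand below is integrable, and $$\int_{\mathbb{R}}\langle x\rangle^{-2s}\Bigl(|e^{\varphi/h}v|^2+|(h\alpha\partial_x+ib)e^{\varphi/h}v|^2\Bigr)dx\le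 C(h)\int_{\mathbb{R}}\langle x\rangle^{2s}|(P(h)-E-i\varepsilon)v|^2dx+|\varepsilon|\,C(h)\int_{\mathbb{R}}|v|^2dx,$$ where $\langle x\rangle=(1+|x|^2)^{1/2}$. -/

import Mathlib

open MeasureTheory Set
open scoped ContDiff

noncomputable section

namespace MagSchrodinger

/-- The bracket `⟨x⟩ = (1 + |x|²)^{1/2}`. -/
def bracket (x : ℝ) : ℝ := (1 + |x| ^ 2) ^ (1 / 2 : ℝ)

/-- The coefficients of the operator `P(h)` at a fixed value of `h`. The magnetic potential is
`b₀ + b₁` and the electric potential is `V₀ + V₁`, where `V₀` is a finite signed Borel measure. -/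
structure Coeffs where
  α : ℝ → ℝ
  β : ℝ → ℝ
  b₀ : ℝ → ℝ
  b₁ : ℝ → ℝ
  V₀ : SignedMeasure ℝ
  V₁ : ℝ → ℝ

namespace Coeffs

/-- The magnetic potential `b = b₀ + b₁`. -/
def b (c : Coeffs) (x : ℝ) : ℝ := c.b₀ x + c.b₁ x

/-- The standing assumptions on the coefficients: `b₀ ∈ L¹ ∩ L²`; `V₁, b₁, α, β` have bounded
variation; `α, β` are bounded below by positive constants. -/
structure Admissible (c : Coeffs) : Prop where
  b₀_memLp_one : MemLp c.b₀ 1 volume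
  b₀_memLp_two : MemLp c.b₀ 2 volume
  V₁_bv : BoundedVariationOn c.V₁ univ
  b₁_bv : BoundedVariationOn c.b₁ univ
  α_bv : BoundedVariationOn c.α univ
  β_bv : BoundedVariationOn c.β univ
  α_lower : ∃ m : ℝ, 0 < m ∧ ∀ x, m ≤ c.α x
  β_lower : ∃ m : ℝ, 0 < m ∧ ∀ x, m ≤ c.β x

/-- The function `β⁻¹ α (E - V₁) + b₁²`. -/
def effective (c : Coeffs) (E : ℝ) (x : ℝ) : ℝ :=
  (c.β x)⁻¹ * c.α x * (E - c.V₁ x) + c.b₁ x ^ 2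

end Coeffs

/-- `w` is the weak (distributional) derivative of `u` on the line. -/
def HasWeakDeriv (u w : ℝ → ℂ) : Prop :=
  LocallyIntegrable u volume ∧ LocallyIntegrable w volume ∧
    ∀ ψ : ℝ → ℝ, ContDiff ℝ ∞ ψ → HasCompactSupport ψ →
      ∫ x, ((deriv ψ x : ℝ) : ℂ) * u x = - ∫ x, ((ψ x : ℝ) : ℂ) * w x

/-- Freezing a function of locally bounded variation outside `[-r, r]` gives a function of bounded
variation. -/
theorem boundedVariationOn_clamp {g : ℝ → ℂ} (hg : LocallyBoundedVariationOn g univ) (r : ℝ) :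
    BoundedVariationOn (fun x => g (max (-r) (min x r))) univ := by
  rcases le_total (-r) r with hr | hr
  · have h1 : MonotoneOn (fun x : ℝ => max (-r) (min x r)) univ := by
      intro x _ y _ hxy
      exact max_le_max le_rfl (min_le_min hxy le_rfl)
    have h2 : MapsTo (fun x : ℝ => max (-r) (min x r)) univ (univ ∩ Icc (-r) r) := by
      intro x _
      exact ⟨mem_univ _, le_max_left _ _, max_le hr (min_le_right _ _)⟩
    have h3 := eVariationOn.comp_le_of_monotoneOn g (fun x : ℝ => max (-r) (min x r)) h1 h2
    exact ne_top_of_le_ne_top (hg (-r) r (mem_univ _) (mem_univ _)) h3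
  · have h1 : (fun x => g (max (-r) (min x r))) = fun _ => g (-r) := by
      funext x
      rw [max_eq_left ((min_le_right x r).trans hr)]
    rw [h1, BoundedVariationOn, eVariationOn.constant_on]
    · simp
    · rintro _ ⟨_, _, rfl⟩ _ ⟨_, _, rfl⟩
      rfl

/-- The restriction to the window `(-r, r)` of the derivative measure `dg` of a function `g` of
locally bounded variation. It is a complex measure that agrees with `dg` on all Borel subsets of
the open interval `(-r, r)`; only its values there are used. -/
def dMeasure {g : ℝ → ℂ} (hg : LocallyBoundedVariationOn g univ) (r : ℝ) : ComplexMeasure ℝ :=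
  (boundedVariationOn_clamp hg r).vectorMeasure

/-- `dg (a, b] = g(b⁺) - g(a⁺)` for subintervals of the window. -/
theorem dMeasure_Ioc {g : ℝ → ℂ} (hg : LocallyBoundedVariationOn g univ) {r a b : ℝ}
    (ha : -r ≤ a) (hab : a ≤ b) (hb : b < r) :
    dMeasure hg r (Ioc a b) = Function.rightLim g b - Function.rightLim g a := by
  have key : ∀ x, -r ≤ x → x < r →
      Function.rightLim (fun x => g (max (-r) (min x r))) x = Function.rightLim g x := by
    intro x hx1 hx2
    have h1 := (boundedVariationOn_clamp hg r).tendsto_rightLim x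
    have h2 : Filter.Tendsto g (nhdsWithin x (Ioi x))
        (nhds (Function.rightLim (fun x => g (max (-r) (min x r))) x)) := by
      refine h1.congr' ?_
      filter_upwards [Ioo_mem_nhdsGT hx2] with y hy
      rw [min_eq_left hy.2.le, max_eq_right (hx1.trans hy.1.le)]
    exact (rightLim_eq_of_tendsto h2).symm
  rw [dMeasure, BoundedVariationOn.vectorMeasure_Ioc _ hab, key b (ha.trans hab) hb,
    key a ha (hab.trans_lt hb)]

/-- `v` lies in the domain `𝒟` of `P(h)` and `f` represents `P(h) v`: that is,
`v ∈ H¹(ℝ)` has weak derivative `dv` and continuous representative `vc`; the function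
`h α v' + i b v` is in `L^∞` and has a representative `g` of locally bounded variation;
`f ∈ L²`; and
`β d(-h² α v' - i h b v) + h β b D_x v + v_c V = f`
as measures on bounded Borel sets, where `D_x = -i ∂_x` and `V = V₀ + V₁ dx`. -/
def IsImage (c : Coeffs) (h : ℝ) (v f : ℝ → ℂ) : Prop :=
  ∃ (dv vc g : ℝ → ℂ) (hg : LocallyBoundedVariationOn g univ),
    MemLp v 2 volume ∧ MemLp dv 2 volume ∧ HasWeakDeriv v dv ∧
    Continuous vc ∧ v =ᵐ[volume] vc ∧
    g =ᵐ[volume] (fun x => (h : ℂ) * c.α x * dv x + Complex.I * c.b x * v x) ∧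
    MemLp g ⊤ volume ∧
    MemLp f 2 volume ∧
    ∀ (r : ℝ) (A : Set ℝ), MeasurableSet A → A ⊆ Ioo (-r) r →
      (-h : ℂ) * (∫ᵛ x in A, c.β x ∂•(dMeasure hg r))
        + (∫ x in A, (h : ℂ) * c.β x * c.b x * (-Complex.I * dv x))
        + ((∫ᵛ x in A, vc x ∂<•c.V₀) + ∫ x in A, vc x * c.V₁ x)
      = ∫ x in A, f x

/-- The domain `𝒟` of `P(h)`. -/
def domain (c : Coeffs) (h : ℝ) : Set (ℝ → ℂ) := {v | ∃ f, IsImage c h v f}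

/-- The operator `P(h)` on `𝒟` (a representative of the almost everywhere class). -/
def op (c : Coeffs) (h : ℝ) (v : domain c h) : ℝ → ℂ := v.2.choose

theorem op_spec (c : Coeffs) (h : ℝ) (v : domain c h) : IsImage c h v (op c h v) :=
  v.2.choose_spec

/-- The phases: `φ` is continuous, nonnegative, even, vanishes at `0`, is smooth on `(0, ∞)`, and
`φ' = k` on `(0, R₁]`, `φ' = 0` on `(2R₁, ∞)`. -/
structure IsPhase (R₁ k : ℝ) (φ : ℝ → ℝ) : Prop where
  continuous : Continuous φ
  nonneg : ∀ x, 0 ≤ φ x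
  zero : φ 0 = 0
  even : ∀ x, φ (-x) = φ x
  smooth : ContDiffOn ℝ ∞ φ (Ioi 0)
  deriv_inner : ∀ x, 0 < x → x ≤ R₁ → deriv φ x = k
  deriv_outer : ∀ x, 2 * R₁ < x → deriv φ x = 0

/-- The conjugated function `e^{φ/h} v`. -/
def conjugated (φ : ℝ → ℝ) (h : ℝ) (v : ℝ → ℂ) (x : ℝ) : ℂ := (Real.exp (φ x / h) : ℂ) * v x

/-- The integrand `⟨x⟩^{-2s} (|u|² + |(h α ∂_x + i b) u|²)` for `u` with weak derivative `du`. -/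
def energyDensity (c : Coeffs) (h s : ℝ) (u du : ℝ → ℂ) (x : ℝ) : ℝ :=
  bracket x ^ (-2 * s) *
    (‖u x‖ ^ 2 + ‖(h : ℂ) * c.α x * du x + Complex.I * c.b x * u x‖ ^ 2)

end MagSchrodinger

end

noncomputable section

namespace MagSchrodinger

/-! Since `h` is fixed and the constant may depend on it, the exponential weight is only a bounded
factor. It is enough to bound `|u|² + |η|²` uniformly on the line, where `u` is the continuous
representative of `v` and `η` a regularized form of the flux `g = hαv' + ibv`. Multiplying by
`⟨x⟩^{-2s}`, which is integrable for `s > 1/2`, then gives the theorem.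

The equation says that `dg` equals `(hβ)⁻¹ v dV₀` plus locally integrable terms, so `g` may jump.
Let `Φ` be the distribution function of `(hβ)⁻¹ V₀`. Then `g⁺ - Φu` is absolutely continuous
(`IsPrimitive.setIntegral_Ioc_eq`), but `Φ` need not decay. Adding back `u` times the unit moving
average of `Φ` keeps absolute continuity and leaves the error `w = Φ - average Φ`. It is dominated
by a unit increment of a bounded monotone function, hence integrable. This yields a first order
system for `(u, η)` (`exists_isFluxSystem`, `exists_isEnergySystem`) whose leading potential is `W =
β⁻¹α(E - V₁) + b₁²`. The remaining real coefficients are in `L¹`, and `b` enters only through skew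
terms.

For `|x| > 2R₁` the phase is flat, so the positivity condition with `φ'` gives `W ≥ τ` there. Let
`S` be the moving average of `max W t₀`, where `t₀ = min τ 1`. Then `S ≥ t₀`, and both `S'` and `S -
W` are integrable, the set `|x| ≤ 2R₁` contributing only a bounded, compactly supported error. In
the derivative of `|η|² + S|u|²` the cross terms combine into `2A(S - W) Re(η ū)`, so Grönwall from
`-∞` gives a sup bound by `|ε|∫|u||η| + ∫|F||η|` (`energy_le`).

To close the estimate, the identity for `Re(η ū)'` integrated over the line controls `‖η‖₂` by
`‖u‖₂` and `‖F‖₂` (`integral_flux_sq_le`). The term `∫|F||η|` is split by a weighted Young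
inequality, one part being absorbed into the supremum (`energy_le_weighted`). -/

/-- `F` is a primitive of the locally integrable function `f`, i.e. `F` is locally absolutely
continuous with almost everywhere derivative `f`. -/
structure IsPrimitive {E : Type*} [NormedAddCommGroup E] [NormedSpace ℝ E] (F f : ℝ → E) :
    Prop where
  locallyIntegrable : LocallyIntegrable f volume
  sub_eq : ∀ a b, F b - F a = ∫ x in a..b, f x

/-! ### Absolutely continuous functions on the line and Grönwall's inequality. -/

section Calculus

theorem _root_.MeasureTheory.LocallyIntegrable.intervalIntegrable_real {E : Type*}
    [NormedAddCommGroup E] {f : ℝ → E}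
    (hf : LocallyIntegrable f volume) (a b : ℝ) : IntervalIntegrable f volume a b :=
  intervalIntegrable_iff.mpr <|
    (hf.integrableOn_isCompact isCompact_uIcc).mono_set uIoc_subset_uIcc

/-- An integrable function is small somewhere on every unbounded interval to the left. -/
theorem exists_lt_norm_lt_of_integrable {E : Type*} [NormedAddCommGroup E]
    {G : ℝ → E} (hG : Integrable G volume) (N : ℝ) {δ : ℝ}
    (hδ : 0 < δ) : ∃ x < N, ‖G x‖ < δ := by
  by_contra! hcon
  have h1 : Integrable (fun _ : ℝ => δ) (volume.restrict (Iio N)) := by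
    refine hG.restrict.mono (by fun_prop) ?_
    refine (ae_restrict_iff' measurableSet_Iio).2 (Filter.Eventually.of_forall fun x hx => ?_)
    rw [Real.norm_of_nonneg hδ.le]
    exact hcon x hx
  rw [integrable_const_iff] at h1
  rcases h1 with h1 | h1
  · exact hδ.ne' h1
  · have := h1.measure_univ_lt_top
    simp at this

theorem exists_seq_tendsto_zero_of_integrable {E : Type*} [NormedAddCommGroup E]
    {G : ℝ → E} (hG : Integrable G volume) :
    ∃ a : ℕ → ℝ, Filter.Tendsto a Filter.atTop Filter.atBot ∧
      Filter.Tendsto (fun n => G (a n)) Filter.atTop (nhds 0) := by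
  choose a ha hGa using fun n : ℕ =>
    exists_lt_norm_lt_of_integrable hG (-n) (δ := 1 / (n + 1)) (by positivity)
  refine ⟨a, ?_, ?_⟩
  · refine Filter.tendsto_atBot_mono (fun n => (ha n).le) ?_
    exact Filter.tendsto_neg_atTop_atBot.comp tendsto_natCast_atTop_atTop
  · exact squeeze_zero_norm (fun n => (hGa n).le) tendsto_one_div_add_atTop_nhds_zero_nat

theorem exists_seq_atTop_tendsto_zero_of_integrable {E : Type*} [NormedAddCommGroup E]
    {G : ℝ → E} (hG : Integrable G volume) :
    ∃ a : ℕ → ℝ, Filter.Tendsto a Filter.atTop Filter.atTop ∧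
      Filter.Tendsto (fun n => G (a n)) Filter.atTop (nhds 0) := by
  obtain ⟨a, ha, h0⟩ := exists_seq_tendsto_zero_of_integrable hG.comp_neg
  exact ⟨fun n => -a n, Filter.tendsto_neg_atBot_atTop.comp ha, h0⟩

variable {E : Type*} [NormedAddCommGroup E] [NormedSpace ℝ E]

theorem isPrimitive_intervalIntegral {f : ℝ → E} (hf : LocallyIntegrable f volume) (c : ℝ) :
    IsPrimitive (fun x => ∫ t in c..x, f t) f := by
  refine ⟨hf, fun a b => ?_⟩
  exact intervalIntegral.integral_interval_sub_left (hf.intervalIntegrable_real _ _)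
    (hf.intervalIntegrable_real _ _)

namespace IsPrimitive

theorem congr_deriv {F f g : ℝ → E} (h : IsPrimitive F f) (hfg : f =ᵐ[volume] g) :
    IsPrimitive F g := by
  refine ⟨h.locallyIntegrable.congr hfg, fun a b => ?_⟩
  rw [h.sub_eq]
  exact intervalIntegral.integral_congr_ae (hfg.mono fun x hx _ => hx)

theorem eq_add_integral {F f : ℝ → E} (h : IsPrimitive F f) (a x : ℝ) :
    F x = F a + ∫ t in a..x, f t := by
  rw [← h.sub_eq]; abel

theorem absolutelyContinuousOnInterval {F f : ℝ → E} (h : IsPrimitive F f) (a b : ℝ) :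
    AbsolutelyContinuousOnInterval F a b := by
  have hn : LocallyIntegrable (fun x => ‖f x‖) volume := fun x =>
    let ⟨s, hs, hi⟩ := h.locallyIntegrable x
    ⟨s, hs, hi.norm⟩
  have hA := (hn.intervalIntegrable_real a b).absolutelyContinuousOnInterval_intervalIntegral
    (c := a) (by simp)
  refine squeeze_zero (fun E => Finset.sum_nonneg fun _ _ => dist_nonneg) (fun E => ?_) hA
  refine Finset.sum_le_sum fun i _ => ?_
  rw [dist_eq_norm', h.sub_eq, dist_comm, Real.dist_eq,
    intervalIntegral.integral_interval_sub_left (hn.intervalIntegrable_real _ _)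
      (hn.intervalIntegrable_real _ _)]
  exact intervalIntegral.norm_integral_le_abs_integral_norm

theorem continuous {F f : ℝ → E} (h : IsPrimitive F f) : Continuous F := by
  refine continuous_iff_continuousAt.2 fun x => ?_
  refine (h.absolutelyContinuousOnInterval (x - 1) (x + 1)).continuousOn.continuousAt ?_
  rw [uIcc_of_le (by linarith)]
  exact Icc_mem_nhds (by linarith) (by linarith)

theorem add {F f G g : ℝ → E} (hF : IsPrimitive F f) (hG : IsPrimitive G g) :
    IsPrimitive (fun x => F x + G x) (fun x => f x + g x) := by
  refine ⟨hF.locallyIntegrable.add hG.locallyIntegrable, fun a b => ?_⟩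
  rw [intervalIntegral.integral_add (hF.locallyIntegrable.intervalIntegrable_real _ _)
    (hG.locallyIntegrable.intervalIntegrable_real _ _), ← hF.sub_eq, ← hG.sub_eq]
  abel

variable [CompleteSpace E]

theorem ae_hasDerivAt {F f : ℝ → E} (h : IsPrimitive F f) : ∀ᵐ x, HasDerivAt F (f x) x := by
  filter_upwards [_root_.LocallyIntegrable.ae_hasDerivAt_integral h.locallyIntegrable] with x hx
  have h1 := (hx 0).const_add (F 0)
  convert! h1 using 1
  funext y
  exact h.eq_add_integral 0 y

/-- Subtracting the integral of `f` leaves an absolutely continuous function with zero derivative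
almost everywhere, hence a constant. -/
theorem of_absolutelyContinuous {F f : ℝ → E} (hf : LocallyIntegrable f volume)
    (hF : ∀ a b, AbsolutelyContinuousOnInterval F a b) (hd : ∀ᵐ x, HasDerivAt F (f x) x) :
    IsPrimitive F f := by
  refine ⟨hf, fun a b => ?_⟩
  have hP := isPrimitive_intervalIntegral hf a
  obtain ⟨C, hC⟩ := ((hF a b).sub
    (hP.absolutelyContinuousOnInterval a b)).const_of_ae_hasDerivAt_zero (by
      filter_upwards [hd, hP.ae_hasDerivAt] with x h1 h2 _
      simpa using h1.sub h2)
  have h1 := hC a (by simp)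
  have h2 := hC b (by simp)
  simp only [Pi.sub_apply, intervalIntegral.integral_same, sub_zero] at h1 h2
  rw [h1, ← h2]; abel

theorem clm {G : Type*} [NormedAddCommGroup G] [NormedSpace ℝ G] [CompleteSpace G] {F f : ℝ → E}
    (L : E →L[ℝ] G) (h : IsPrimitive F f) :
    IsPrimitive (fun x => L (F x)) (fun x => L (f x)) := by
  refine ⟨fun x => ?_, fun a b => ?_⟩
  · obtain ⟨s, hs, hi⟩ := h.locallyIntegrable x
    exact ⟨s, hs, L.integrable_comp hi⟩
  · rw [← map_sub, h.sub_eq,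
      L.intervalIntegral_comp_comm (h.locallyIntegrable.intervalIntegrable_real _ _)]

theorem mul {𝕜 : Type*} [RCLike 𝕜] {F f G g : ℝ → 𝕜} (hF : IsPrimitive F f)
    (hG : IsPrimitive G g) :
    IsPrimitive (fun x => F x * G x) (fun x => f x * G x + F x * g x) := by
  refine of_absolutelyContinuous ?_ (fun a b => ?_) ?_
  · exact (hF.locallyIntegrable.mul_continuous hG.continuous).add
      (hG.locallyIntegrable.continuous_mul hF.continuous)
  · exact (hF.absolutelyContinuousOnInterval a b).smul (hG.absolutelyContinuousOnInterval a b)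
  · filter_upwards [hF.ae_hasDerivAt, hG.ae_hasDerivAt] with x h1 h2
    exact h1.mul h2

theorem normSq {F f : ℝ → ℂ} (hF : IsPrimitive F f) :
    IsPrimitive (fun x => ‖F x‖ ^ 2) (fun x => 2 * (f x * star (F x)).re) := by
  have h1 := ((hF.mul (hF.clm (Complex.conjCLE : ℂ →L[ℝ] ℂ))).clm Complex.reCLM)
  convert! h1 using 1
  · funext x
    simp only [ContinuousLinearEquiv.coe_coe, Complex.conjCLE_apply, Complex.mul_conj,
      Complex.normSq_eq_norm_sq, Complex.reCLM_apply, Complex.ofReal_re]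
  · funext x
    simp
    ring

theorem exp_neg {F f : ℝ → ℝ} (hF : IsPrimitive F f) :
    IsPrimitive (fun x => Real.exp (-F x)) (fun x => -f x * Real.exp (-F x)) := by
  refine of_absolutelyContinuous ?_ (fun a b => ?_) ?_
  · exact hF.locallyIntegrable.neg.mul_continuous (Real.continuous_exp.comp hF.continuous.neg)
  · obtain ⟨C, hC⟩ := (hF.absolutelyContinuousOnInterval a b).exists_bound
    -- The exponential is only locally Lipschitz. This suffices because `F` is bounded on the
    -- interval, and Lipschitz functions preserve absolute continuity.
    have hlip : ∃ K, LipschitzOnWith K (fun y => Real.exp (-y)) (Icc (-C) C) :=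
      ContDiffOn.exists_lipschitzOnWith (n := 1) (by fun_prop) (by decide) (convex_Icc _ _)
        isCompact_Icc
    obtain ⟨K, hK⟩ := hlip
    have h1 := (hF.absolutelyContinuousOnInterval a b).const_mul (K : ℝ)
    unfold AbsolutelyContinuousOnInterval at h1 ⊢
    refine squeeze_zero' (Filter.Eventually.of_forall fun E =>
      Finset.sum_nonneg fun _ _ => dist_nonneg) ?_ h1
    refine Filter.eventually_inf_principal.2 (Filter.Eventually.of_forall fun E hE => ?_)
    refine Finset.sum_le_sum fun i hi => ?_
    obtain ⟨h2, h3⟩ := hE.1 i hi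
    refine (hK.dist_le_mul _ (abs_le.1 (hC _ h2)) _ (abs_le.1 (hC _ h3))).trans (le_of_eq ?_)
    rw [Real.dist_eq, Real.dist_eq, ← mul_sub, abs_mul, abs_of_nonneg K.coe_nonneg]
  · filter_upwards [hF.ae_hasDerivAt] with x h1
    have := h1.neg.exp
    rwa [mul_comm] at this

theorem of_hasDerivAt_off_countable {F f : ℝ → E} {s : Set ℝ} (hs : s.Countable)
    (hF : Continuous F) (hd : ∀ x ∉ s, HasDerivAt F (f x) x) (hf : LocallyIntegrable f volume) :
    IsPrimitive F f :=
  ⟨hf, fun a b => (MeasureTheory.integral_eq_of_hasDerivAt_off_countable F f hs hF.continuousOn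
    (fun x hx => hd x hx.2) (hf.intervalIntegrable_real a b)).symm⟩

end IsPrimitive

/-- Integrability of `F` does not give limits at infinity directly, but it gives sequences tending
to `±∞` along which `F` vanishes. -/
theorem IsPrimitive.integral_eq_zero {F f : ℝ → E} (h : IsPrimitive F f)
    (hF : Integrable F volume) (hf : Integrable f volume) : ∫ x, f x = 0 := by
  obtain ⟨a, ha, ha0⟩ := exists_seq_tendsto_zero_of_integrable hF
  obtain ⟨b, hb, hb0⟩ := exists_seq_atTop_tendsto_zero_of_integrable hF
  have h1 := intervalIntegral_tendsto_integral hf ha hb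
  have h2 : Filter.Tendsto (fun n => F (b n) - F (a n)) Filter.atTop (nhds (0 - 0)) :=
    hb0.sub ha0
  simp_rw [h.sub_eq, sub_zero] at h2
  exact tendsto_nhds_unique h1 h2

/-- Grönwall's inequality on the line, with vanishing data at `-∞` in the integrated sense. -/
theorem IsPrimitive.gronwall {G g p q : ℝ → ℝ} (h : IsPrimitive G g) (hG : Integrable G volume)
    (hp : Integrable p volume) (hp0 : ∀ x, 0 ≤ p x) (hq : Integrable q volume)
    (hq0 : ∀ᵐ x, 0 ≤ q x) (hle : ∀ᵐ x, g x ≤ p x * G x + q x) (x : ℝ) :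
    G x ≤ Real.exp (∫ t, p t) * ∫ t, q t := by
  obtain ⟨a, ha, ha0⟩ := exists_seq_tendsto_zero_of_integrable hG
  have hlim : Filter.Tendsto
      (fun n => Real.exp (∫ t, p t) * (‖G (a n)‖ + ∫ t, q t)) Filter.atTop
      (nhds (Real.exp (∫ t, p t) * (0 + ∫ t, q t))) :=
    Filter.Tendsto.const_mul _ ((tendsto_zero_iff_norm_tendsto_zero.1 ha0).add_const _)
  rw [zero_add] at hlim
  refine ge_of_tendsto hlim ?_
  filter_upwards [ha.eventually_le_atBot x] with n hn
  have hA := (isPrimitive_intervalIntegral hp.locallyIntegrable (a n))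
  have hM := h.mul hA.exp_neg
  -- Multiplying by the integrating factor `exp(-∫p)` removes the term `p G`. The factor is at most
  -- 1 to the right of `a n`, so it can be dropped from `q`.
  have hAx : ∀ y, a n ≤ y → 0 ≤ ∫ t in (a n)..y, p t := fun y hy =>
    intervalIntegral.integral_nonneg hy fun t _ => hp0 t
  have h1 := hM.sub_eq (a n) x
  simp only [intervalIntegral.integral_same, neg_zero, Real.exp_zero, mul_one] at h1
  have h2 : (∫ y in (a n)..x, g y * Real.exp (-∫ t in (a n)..y, p t) +
      G y * (-p y * Real.exp (-∫ t in (a n)..y, p t))) ≤ ∫ y in (a n)..x, q y := by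
    refine intervalIntegral.integral_mono_ae_restrict hn
      (hM.locallyIntegrable.intervalIntegrable_real _ _)
      (hq.locallyIntegrable.intervalIntegrable_real _ _) ?_
    refine (ae_restrict_iff' measurableSet_Icc).2 ?_
    filter_upwards [hle, hq0] with y hy hq0y hyI
    have h3 : Real.exp (-∫ t in (a n)..y, p t) ≤ 1 :=
      Real.exp_le_one_iff.2 (neg_nonpos.2 (hAx y hyI.1))
    have h4 := Real.exp_pos (-∫ t in (a n)..y, p t)
    calc _ = (g y - p y * G y) * Real.exp (-∫ t in (a n)..y, p t) := by ring
      _ ≤ q y * Real.exp (-∫ t in (a n)..y, p t) := by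
        gcongr; linarith
      _ ≤ q y * 1 := by gcongr
      _ = q y := mul_one _
  have h3 : (∫ y in (a n)..x, q y) ≤ ∫ y, q y := by
    rw [intervalIntegral.integral_of_le hn]
    exact setIntegral_le_integral hq hq0
  have h4 : (∫ y in (a n)..x, p y) ≤ ∫ y, p y := by
    rw [intervalIntegral.integral_of_le hn]
    exact setIntegral_le_integral hp (Filter.Eventually.of_forall hp0)
  have h5 : G x * Real.exp (-∫ t in (a n)..x, p t) ≤ ‖G (a n)‖ + ∫ t, q t := by
    have := Real.le_norm_self (G (a n))
    linarith
  calc G x = Real.exp (∫ t in (a n)..x, p t) * (G x * Real.exp (-∫ t in (a n)..x, p t)) := by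
        rw [mul_left_comm, ← Real.exp_add]; simp
    _ ≤ Real.exp (∫ t in (a n)..x, p t) * (‖G (a n)‖ + ∫ t, q t) := by gcongr
    _ ≤ _ := by
      have : 0 ≤ ‖G (a n)‖ + ∫ t, q t := add_nonneg (norm_nonneg _) (integral_nonneg_of_ae hq0)
      gcongr

end Calculus

/-! ### Functions of bounded variation and their moving averages. -/

/-- The increments of `f` are dominated by those of the bounded monotone function `N`. -/
structure VariationBound (f N : ℝ → ℝ) : Prop where
  monotone : Monotone N
  bounded : ∃ C, ∀ x, |N x| ≤ C
  abs_sub_le : ∀ x y, x ≤ y → |f y - f x| ≤ N y - N x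

theorem _root_.BoundedVariationOn.exists_variationBound {f : ℝ → ℝ}
    (hf : BoundedVariationOn f univ) : ∃ N, VariationBound f N := by
  refine ⟨variationOnFromTo f univ 0, ?_, ⟨(eVariationOn f univ).toReal, fun x => ?_⟩,
    fun x y hxy => ?_⟩
  · exact monotoneOn_univ.1
      (variationOnFromTo.monotoneOn hf.locallyBoundedVariationOn (mem_univ _))
  · exact variationOnFromTo.abs_le_eVariationOn hf
  · have h1 := variationOnFromTo.add hf.locallyBoundedVariationOn (mem_univ 0) (mem_univ x)
      (mem_univ y)
    rw [← h1, add_sub_cancel_left, variationOnFromTo.eq_of_le _ _ hxy, ← Real.dist_eq]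
    have h2 : BoundedVariationOn f (univ ∩ Icc x y) := hf.mono inter_subset_left
    exact h2.dist_le ⟨mem_univ _, right_mem_Icc.2 hxy⟩ ⟨mem_univ _, left_mem_Icc.2 hxy⟩

namespace VariationBound

variable {f g N M : ℝ → ℝ}

theorem exists_abs_le (hf : VariationBound f N) : ∃ C, 0 ≤ C ∧ ∀ x, |f x| ≤ C := by
  obtain ⟨C, hC⟩ := hf.bounded
  have key : ∀ x, |f x - f 0| ≤ 2 * C := by
    intro x
    have hx := abs_le.1 (hC x)
    have h0 := abs_le.1 (hC 0)
    rcases le_total 0 x with h | h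
    · linarith [hf.abs_sub_le 0 x h]
    · rw [abs_sub_comm]; linarith [hf.abs_sub_le x 0 h]
  refine ⟨|f 0| + 2 * C, ?_, fun x => ?_⟩
  · have := (abs_nonneg _).trans (hC 0)
    positivity
  · calc |f x| = |f 0 + (f x - f 0)| := by ring_nf
      _ ≤ |f 0| + |f x - f 0| := abs_add_le _ _
      _ ≤ _ := by linarith [key x]

theorem measurable (hf : VariationBound f N) : Measurable f := by
  have h1 : Monotone fun x => f x + N x := fun x y hxy => by
    have := (abs_le.1 (hf.abs_sub_le x y hxy)).1
    dsimp only; linarith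
  convert! h1.measurable.sub hf.monotone.measurable using 1
  funext x
  simp

theorem add (hf : VariationBound f N) (hg : VariationBound g M) :
    VariationBound (fun x => f x + g x) (fun x => N x + M x) := by
  obtain ⟨C, hC⟩ := hf.bounded
  obtain ⟨D, hD⟩ := hg.bounded
  refine ⟨hf.monotone.add hg.monotone, ⟨C + D, fun x => ?_⟩, fun x y hxy => ?_⟩
  · exact (abs_add_le _ _).trans (add_le_add (hC x) (hD x))
  · have h1 := hf.abs_sub_le x y hxy
    have h2 := hg.abs_sub_le x y hxy
    calc |f y + g y - (f x + g x)| = |(f y - f x) + (g y - g x)| := by ring_nf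
      _ ≤ _ := (abs_add_le _ _).trans (by linarith)

theorem of_le {K : ℝ} (hK : 0 ≤ K) (hf : VariationBound f N)
    (h : ∀ x y, |g y - g x| ≤ K * |f y - f x|) : VariationBound g (fun x => K * N x) := by
  obtain ⟨C, hC⟩ := hf.bounded
  refine ⟨hf.monotone.const_mul hK, ⟨K * C, fun x => ?_⟩, fun x y hxy => ?_⟩
  · rw [abs_mul, abs_of_nonneg hK]; gcongr; exact hC x
  · rw [← mul_sub]
    exact (h x y).trans (mul_le_mul_of_nonneg_left (hf.abs_sub_le x y hxy) hK)

theorem const_mul (hf : VariationBound f N) (K : ℝ) :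
    VariationBound (fun x => K * f x) (fun x => |K| * N x) :=
  hf.of_le (abs_nonneg K) fun x y => by rw [← mul_sub, abs_mul]

theorem mul (hf : VariationBound f N) (hg : VariationBound g M) :
    ∃ L, VariationBound (fun x => f x * g x) L := by
  obtain ⟨C, hC0, hC⟩ := hf.exists_abs_le
  obtain ⟨D, hD0, hD⟩ := hg.exists_abs_le
  have h1 : VariationBound (fun x => D * f x) (fun x => |D| * N x) := hf.const_mul D
  have h2 : VariationBound (fun x => C * g x) (fun x => |C| * M x) := hg.const_mul C
  have h3 := h1.add h2
  refine ⟨_, h3.monotone, h3.bounded, fun x y hxy => ?_⟩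
  rw [abs_of_nonneg hC0, abs_of_nonneg hD0]
  have e1 := hf.abs_sub_le x y hxy
  have e2 := hg.abs_sub_le x y hxy
  calc |f y * g y - f x * g x| = |(f y - f x) * g y + f x * (g y - g x)| := by ring_nf
    _ ≤ |f y - f x| * |g y| + |f x| * |g y - g x| := by
        rw [← abs_mul, ← abs_mul]; exact abs_add_le _ _
    _ ≤ (N y - N x) * D + C * (M y - M x) := by
        gcongr
        · exact (abs_nonneg _).trans e1
        · exact hD y
        · exact hC x
    _ = _ := by ring

theorem inv (hf : VariationBound f N) {m : ℝ} (hm : 0 < m) (h : ∀ x, m ≤ f x) :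
    ∃ L, VariationBound (fun x => (f x)⁻¹) L := by
  refine ⟨_, hf.of_le (K := (m * m)⁻¹) (by positivity) fun x y => ?_⟩
  have hx := hm.trans_le (h x)
  have hy := hm.trans_le (h y)
  rw [inv_sub_inv hy.ne' hx.ne', abs_div, abs_sub_comm, abs_of_pos (mul_pos hy hx), div_eq_inv_mul]
  gcongr
  · exact h y
  · exact h x

theorem max_const (hf : VariationBound f N) (t : ℝ) : VariationBound (fun x => max (f x) t) N :=
  ⟨hf.monotone, hf.bounded, fun x y hxy =>
    (abs_max_sub_max_le_abs _ _ _).trans (hf.abs_sub_le x y hxy)⟩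

theorem locallyIntegrable (hf : VariationBound f N) : LocallyIntegrable f volume := by
  obtain ⟨C, -, hC⟩ := hf.exists_abs_le
  refine (locallyIntegrable_const C).mono hf.measurable.aestronglyMeasurable ?_
  exact Filter.Eventually.of_forall fun x => (hC x).trans (le_abs_self C)

theorem increment_nonneg (hf : VariationBound f N) (x : ℝ) : 0 ≤ N (x + 1) - N x :=
  sub_nonneg.2 (hf.monotone (by linarith))

theorem self (hf : VariationBound f N) : VariationBound N N :=
  ⟨hf.monotone, hf.bounded, fun _ _ hxy => (abs_of_nonneg (sub_nonneg.2 (hf.monotone hxy))).le⟩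

/-- The moving average `∫_x^{x+1} f`. -/
def _root_.MagSchrodinger.average (f : ℝ → ℝ) (x : ℝ) : ℝ := ∫ t in x..(x + 1), f t

/-- Averaging makes a function with jumps absolutely continuous, at the cost of an integrable
derivative and an integrable error. -/
theorem isPrimitive_average (hf : VariationBound f N) :
    IsPrimitive (average f) (fun x => f (x + 1) - f x) := by
  have hi := hf.locallyIntegrable
  have hi1 : LocallyIntegrable (fun x => f (x + 1)) volume := by
    obtain ⟨C, -, hC⟩ := hf.exists_abs_le
    refine (locallyIntegrable_const C).mono
      (hf.measurable.comp (measurable_id.add_const 1)).aestronglyMeasurable ?_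
    exact Filter.Eventually.of_forall fun x => (hC _).trans (le_abs_self C)
  refine ⟨hi1.sub hi, fun a b => ?_⟩
  rw [intervalIntegral.integral_sub (hi1.intervalIntegrable_real _ _)
    (hi.intervalIntegrable_real _ _), intervalIntegral.integral_comp_add_right]
  have h1 := intervalIntegral.integral_add_adjacent_intervals
    (hi.intervalIntegrable_real a (a + 1)) (hi.intervalIntegrable_real (a + 1) (b + 1))
  have h2 := intervalIntegral.integral_add_adjacent_intervals
    (hi.intervalIntegrable_real a b) (hi.intervalIntegrable_real b (b + 1))
  unfold average
  linarith

/-- The nonnegative increment is the derivative of the bounded function `average N`, so its integral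
over `[-n, n]` stays below twice the bound. -/
theorem integrable_increment (hf : VariationBound f N) :
    Integrable (fun x => N (x + 1) - N x) volume := by
  have hP := hf.self.isPrimitive_average
  obtain ⟨C, hC0, hC⟩ := hf.self.exists_abs_le
  have hS : ∀ x, |average N x| ≤ C := fun x => by
    refine (intervalIntegral.norm_integral_le_of_norm_le_const (f := N)
      fun t _ => hC t).trans ?_
    simp
  refine integrable_of_intervalIntegral_norm_bounded (l := Filter.atTop) (2 * C)
    (a := fun n : ℕ => -(n : ℝ)) (b := fun n : ℕ => (n : ℝ))
    (fun n => (hP.locallyIntegrable.intervalIntegrable_real _ _).1)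
    (Filter.tendsto_neg_atTop_atBot.comp tendsto_natCast_atTop_atTop)
    tendsto_natCast_atTop_atTop (Filter.Eventually.of_forall fun n => ?_)
  have h1 : ∀ x, ‖N (x + 1) - N x‖ = N (x + 1) - N x := fun x =>
    Real.norm_of_nonneg (hf.increment_nonneg x)
  simp_rw [h1]
  rw [← hP.sub_eq]
  have h2 := abs_le.1 (hS (n : ℝ))
  have h3 := abs_le.1 (hS (-(n : ℝ)))
  linarith

theorem abs_average_sub_le (hf : VariationBound f N) (x : ℝ) :
    |average f x - f x| ≤ N (x + 1) - N x := by
  have h1 : average f x - f x = ∫ t in x..(x + 1), (f t - f x) := by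
    rw [intervalIntegral.integral_sub (hf.locallyIntegrable.intervalIntegrable_real _ _) (by simp)]
    simp [average]
  rw [h1]
  suffices h2 : ∀ t ∈ uIoc x (x + 1), ‖f t - f x‖ ≤ N (x + 1) - N x by
    simpa using! intervalIntegral.norm_integral_le_of_norm_le_const h2
  intro t ht
  rw [uIoc_of_le (by linarith)] at ht
  refine (hf.abs_sub_le x t ht.1.le).trans ?_
  linarith [hf.monotone ht.2]

theorem le_average (hf : VariationBound f N) {m : ℝ} (hm : ∀ x, m ≤ f x) (x : ℝ) :
    m ≤ average f x := by
  have := intervalIntegral.integral_mono_on (a := x) (b := x + 1) (by linarith)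
    (intervalIntegrable_const (c := m)) (hf.locallyIntegrable.intervalIntegrable_real x (x + 1))
    fun t _ => hm t
  simpa [average] using! this

theorem abs_average_le {C : ℝ} (hC : ∀ x, |f x| ≤ C) (x : ℝ) :
    |average f x| ≤ C := by
  refine (intervalIntegral.norm_integral_le_of_norm_le_const (f := f)
    fun t _ => hC t).trans ?_
  simp

end VariationBound

/-! ### Integration against signed and complex measures, and division by a coefficient. -/

theorem _root_.MeasureTheory.SignedMeasure.isFiniteMeasure_variation {X : Type*}
    [MeasurableSpace X] (m : SignedMeasure X) : IsFiniteMeasure m.variation := by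
  rw [← SignedMeasure.totalVariation_eq_variation]
  infer_instance

theorem _root_.MeasureTheory.ComplexMeasure.isFiniteMeasure_variation {X : Type*}
    [MeasurableSpace X] (m : ComplexMeasure X) : IsFiniteMeasure m.variation := by
  have h1 := (ComplexMeasure.re m).isFiniteMeasure_variation
  have h2 := (ComplexMeasure.im m).isFiniteMeasure_variation
  refine isFiniteMeasure_of_le
    ((ComplexMeasure.re m).variation + (ComplexMeasure.im m).variation)
    (VectorMeasure.variation_le_of_forall_enorm_le fun A _ => ?_)
  have h3 : m A = ((ComplexMeasure.re m A : ℝ) : ℂ) + ((ComplexMeasure.im m A : ℝ) : ℂ) * Complex.I :=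
    (Complex.re_add_im (m A)).symm
  rw [h3, Measure.add_apply]
  refine (enorm_add_le _ _).trans (add_le_add ?_ ?_)
  · rw [show ‖((ComplexMeasure.re m A : ℝ) : ℂ)‖ₑ = ‖ComplexMeasure.re m A‖ₑ by
      simp [enorm_eq_nnnorm]]
    exact VectorMeasure.enorm_measure_le_variation _ _
  · rw [enorm_mul, show ‖((ComplexMeasure.im m A : ℝ) : ℂ)‖ₑ = ‖ComplexMeasure.im m A‖ₑ by
      simp [enorm_eq_nnnorm], show ‖Complex.I‖ₑ = 1 by simp [enorm_eq_nnnorm], mul_one]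
    exact VectorMeasure.enorm_measure_le_variation _ _

theorem setIntegral_signedMeasure_eq_sub {X : Type*} [MeasurableSpace X] (V : SignedMeasure X)
    {f : X → ℂ} {A : Set X} (hA : MeasurableSet A)
    (hP : IntegrableOn f A V.toJordanDecomposition.posPart)
    (hN : IntegrableOn f A V.toJordanDecomposition.negPart) :
    ∫ᵛ x in A, f x ∂<•V = (∫ x in A, f x ∂V.toJordanDecomposition.posPart)
      - ∫ x in A, f x ∂V.toJordanDecomposition.negPart := by
  nth_rw 1 [← V.toSignedMeasure_toJordanDecomposition]
  rw [JordanDecomposition.toSignedMeasure, VectorMeasure.restrict_sub,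
    VectorMeasure.integral_sub_vectorMeasure, VectorMeasure.setIntegral_toSignedMeasure hA,
    VectorMeasure.setIntegral_toSignedMeasure hA]
  · rw [VectorMeasure.restrict_toSignedMeasure hA]
    simpa [VectorMeasure.Integrable] using! hP
  · rw [VectorMeasure.restrict_toSignedMeasure hA]
    simpa [VectorMeasure.Integrable] using! hN

section Division

variable {X : Type*} [MeasurableSpace X] {m : ComplexMeasure X} {μ P N : Measure X}
  {ρ u : X → ℂ} {β : X → ℝ}

/-- If `β m = ρ μ + u (P - N)` as complex measures, the same identity holds after integrating a
simple function. -/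
theorem integral_simpleFunc_mul (hβ : m.Integrable β)
    (hρ : Integrable ρ μ) (hP : Integrable u P) (hN : Integrable u N)
    (H : ∀ A, MeasurableSet A → ∫ᵛ x in A, β x ∂•m
      = (∫ x in A, ρ x ∂μ) + ((∫ x in A, u x ∂P) - ∫ x in A, u x ∂N)) (k : SimpleFunc X ℝ) :
    ∫ᵛ x, k x * β x ∂•m
      = (∫ x, (k x : ℂ) * ρ x ∂μ) + ((∫ x, (k x : ℂ) * u x ∂P) - ∫ x, (k x : ℂ) * u x ∂N) := by
  have hint : ∀ (k : SimpleFunc X ℝ) {ν : Measure X} {f : X → ℂ}, Integrable f ν →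
      Integrable (fun x => (k x : ℂ) * f x) ν := by
    intro k ν f hf
    obtain ⟨C, hC⟩ := k.exists_forall_norm_le
    refine hf.bdd_mul (c := C) ?_ (Filter.Eventually.of_forall fun x => ?_)
    · exact (Complex.measurable_ofReal.comp k.measurable).aestronglyMeasurable
    · rw [Complex.norm_real]; exact hC x
  have hintR : ∀ (k : SimpleFunc X ℝ), m.Integrable (fun x => k x * β x) := by
    intro k
    obtain ⟨C, hC⟩ := k.exists_forall_norm_le
    exact Integrable.bdd_mul (c := C) hβ k.measurable.aestronglyMeasurable
      (Filter.Eventually.of_forall hC)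
  induction k using SimpleFunc.induction with
  | const c hs =>
    rename_i s
    have e1 : (fun x => (SimpleFunc.piecewise s hs (SimpleFunc.const _ c)
        (SimpleFunc.const _ 0)) x * β x) = s.indicator (fun x => c • β x) := by
      funext x
      by_cases hx : x ∈ s <;> simp [hx]
    have e2 : ∀ f : X → ℂ, (fun x => (((SimpleFunc.piecewise s hs (SimpleFunc.const _ c)
        (SimpleFunc.const _ 0)) x : ℝ) : ℂ) * f x) = s.indicator (fun x => (c : ℂ) * f x) := by
      intro f
      funext x
      by_cases hx : x ∈ s <;> simp [hx]
    rw [e1, e2, e2, VectorMeasure.integral_indicator hs, VectorMeasure.integral_fun_smul, H s hs,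
      integral_indicator hs, integral_indicator hs, integral_indicator hs, integral_const_mul,
      integral_const_mul, integral_const_mul, Complex.real_smul]
    ring
  | @add k l _ hk hl =>
    have e1 : (fun x => (k + l) x * β x) = fun x => k x * β x + l x * β x := by
      funext x; simp [add_mul]
    have e2 : ∀ f : X → ℂ, (fun x => (((k + l) x : ℝ) : ℂ) * f x) =
        fun x => (k x : ℂ) * f x + (l x : ℂ) * f x := by
      intro f; funext x; simp [add_mul]
    rw [e1, e2, e2, VectorMeasure.integral_fun_add (hintR k) (hintR l), hk, hl,
      integral_add (hint k hρ) (hint l hρ), integral_add (hint k hP) (hint l hP),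
      integral_add (hint k hN) (hint l hN)]
    ring

/-- A complex measure whose product with `β` is known can be recovered by dividing by `β`. -/
theorem apply_univ_eq_integral_div {a C : ℝ} (ha : 0 < a) (hβm : Measurable β)
    (hβa : ∀ x, a ≤ β x) (hβC : ∀ x, β x ≤ C)
    (hρ : Integrable ρ μ) (hP : Integrable u P) (hN : Integrable u N)
    (H : ∀ A, MeasurableSet A → ∫ᵛ x in A, β x ∂•m
      = (∫ x in A, ρ x ∂μ) + ((∫ x in A, u x ∂P) - ∫ x in A, u x ∂N)) :
    m univ = (∫ x, ((β x)⁻¹ : ℝ) * ρ x ∂μ)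
      + ((∫ x, ((β x)⁻¹ : ℝ) * u x ∂P) - ∫ x, ((β x)⁻¹ : ℝ) * u x ∂N) := by
  have := m.isFiniteMeasure_variation
  have hβ0 : ∀ x, 0 < β x := fun x => ha.trans_le (hβa x)
  have hβi : m.Integrable β := by
    refine Integrable.of_bound (C := C) hβm.aestronglyMeasurable
      (Filter.Eventually.of_forall fun x => ?_)
    rw [Real.norm_of_nonneg (hβ0 x).le]
    exact hβC x
  have hK : StronglyMeasurable fun x => (β x)⁻¹ := hβm.inv.stronglyMeasurable
  have hKb : ∀ x, ‖(β x)⁻¹‖ ≤ a⁻¹ := fun x => by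
    rw [Real.norm_of_nonneg (inv_nonneg.2 (hβ0 x).le)]
    exact inv_anti₀ ha (hβa x)
  -- Simple functions bounded by `a⁻¹` that converge to `β⁻¹` at every point. Pointwise convergence
  -- everywhere is needed because the same sequence is used for `m`, `μ`, `P` and `N`, which may be
  -- mutually singular.
  set k := fun n => hK.approxBounded a⁻¹ n with hk
  have hkb : ∀ n x, ‖k n x‖ ≤ a⁻¹ := fun n x => hK.norm_approxBounded_le (inv_nonneg.2 ha.le) n x
  have hkt : ∀ x, Filter.Tendsto (fun n => k n x) Filter.atTop (nhds (β x)⁻¹) := fun x =>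
    hK.tendsto_approxBounded_of_norm_le (hKb x)
  have hlim : ∀ {ν : Measure X} {f : X → ℂ}, Integrable f ν →
      Filter.Tendsto (fun n => ∫ x, (k n x : ℂ) * f x ∂ν) Filter.atTop
        (nhds (∫ x, ((β x)⁻¹ : ℝ) * f x ∂ν)) := by
    intro ν f hf
    refine tendsto_integral_of_dominated_convergence (fun x => a⁻¹ * ‖f x‖) (fun n => ?_)
      (hf.norm.const_mul _) (fun n => Filter.Eventually.of_forall fun x => ?_)
      (Filter.Eventually.of_forall fun x => ?_)
    · exact (Complex.measurable_ofReal.comp (k n).measurable).aestronglyMeasurable.mul hf.1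
    · rw [norm_mul, Complex.norm_real]
      gcongr
      exact hkb n x
    · exact ((Complex.continuous_ofReal.tendsto _).comp (hkt x)).mul_const _
  have hlimV : Filter.Tendsto (fun n => ∫ᵛ x, k n x * β x ∂•m) Filter.atTop
      (nhds (∫ᵛ x, (β x)⁻¹ * β x ∂•m)) := by
    refine VectorMeasure.tendsto_integral_of_dominated_convergence (fun x => a⁻¹ * ‖β x‖)
      (fun n => ?_) (hβi.norm.const_mul _) (fun n => Filter.Eventually.of_forall fun x => ?_)
      (Filter.Eventually.of_forall fun x => (hkt x).mul_const _)
    · exact ((k n).measurable.mul hβm).aestronglyMeasurable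
    · rw [norm_mul]
      gcongr
      exact hkb n x
  have h1 : ∫ᵛ x, (β x)⁻¹ * β x ∂•m = m univ := by
    simp_rw [inv_mul_cancel₀ (hβ0 _).ne']
    rw [VectorMeasure.integral_const]
    simp
  rw [← h1]
  refine tendsto_nhds_unique hlimV ?_
  simp_rw [integral_simpleFunc_mul hβi hρ hP hN H]
  exact (hlim hρ).add ((hlim hP).sub (hlim hN))

end Division

/-! ### Distribution functions and integration by parts against a measure. -/

section DistributionFunction

/-- The function `x ↦ ∫_{(-∞, x]} K dP`. -/
def cumulative (P : Measure ℝ) (K : ℝ → ℝ) (x : ℝ) : ℝ := ∫ t in Iic x, K t ∂P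

theorem integral_Ioc_eq_cumulative_sub {P : Measure ℝ} {K : ℝ → ℝ} (hK : Integrable K P) {a b : ℝ}
    (hab : a ≤ b) : ∫ t in Ioc a b, K t ∂P = cumulative P K b - cumulative P K a := by
  have h := setIntegral_union (μ := P) (f := K) (s := Iic a) (t := Ioc a b)
    (Iic_disjoint_Ioc le_rfl) measurableSet_Ioc hK.integrableOn hK.integrableOn
  rw [Iic_union_Ioc_eq_Iic hab] at h
  rw [cumulative, cumulative, h]; ring

theorem variationBound_cumulative {P : Measure ℝ} {K : ℝ → ℝ} (hK : Integrable K P)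
    (hK0 : ∀ x, 0 ≤ K x) : VariationBound (cumulative P K) (cumulative P K) := by
  have hm : Monotone (cumulative P K) := fun x y hxy => by
    rw [← sub_nonneg, ← integral_Ioc_eq_cumulative_sub hK hxy]
    exact integral_nonneg fun t => hK0 t
  refine ⟨hm, ⟨∫ t, K t ∂P, fun x => ?_⟩, fun x y hxy => ?_⟩
  · rw [cumulative, abs_of_nonneg (integral_nonneg hK0)]
    exact setIntegral_le_integral hK (Filter.Eventually.of_forall hK0)
  · rw [abs_of_nonneg (sub_nonneg.2 (hm hxy))]

/-- Integration by parts of an absolutely continuous function against a finite measure. -/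
theorem IsPrimitive.setIntegral_Ioc_eq {P : Measure ℝ} [IsFiniteMeasure P] {K : ℝ → ℝ}
    (hK : Integrable K P) {u du : ℝ → ℂ} (hu : IsPrimitive u du) {a b : ℝ}
    (hab : a ≤ b) :
    ∫ t in Ioc a b, (K t : ℂ) * u t ∂P
      = (cumulative P K b * u b - cumulative P K a * u a)
        - ∫ x in a..b, (cumulative P K x : ℂ) * du x := by
  set Φ := cumulative P K with hΦ
  have hdu : Integrable du (volume.restrict (Ioc a b)) :=
    (hu.locallyIntegrable.intervalIntegrable_real a b).1
  have hK' : Integrable (fun t => (K t : ℂ)) (P.restrict (Ioc a b)) := hK.ofReal.restrict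
  -- Fubini on the triangle `t ≤ s`. The inequality is weak so that atoms of `P` agree with the
  -- right-continuous convention `Iic` in `cumulative`.
  set F : ℝ × ℝ → ℂ := {z : ℝ × ℝ | z.1 ≤ z.2}.indicator fun z => (K z.1 : ℂ) * du z.2 with hF
  have hs : MeasurableSet {z : ℝ × ℝ | z.1 ≤ z.2} := measurableSet_le measurable_fst measurable_snd
  have hFi : Integrable F ((P.restrict (Ioc a b)).prod (volume.restrict (Ioc a b))) :=
    (hK'.mul_prod hdu).indicator hs
  have hswap := integral_integral_swap (f := fun t s => F (t, s)) hFi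
  have h1 : ∀ t ∈ Ioc a b, ∫ s in Ioc a b, F (t, s) = (K t : ℂ) * (u b - u t) := by
    intro t ht
    have e1 : (fun s => F (t, s)) = (Ici t).indicator fun s => (K t : ℂ) * du s := by
      funext s
      by_cases h : t ≤ s <;> simp [hF, h]
    rw [e1, setIntegral_indicator measurableSet_Ici, integral_const_mul, hu.sub_eq,
      intervalIntegral.integral_of_le ht.2, ← integral_Icc_eq_integral_Ioc]
    congr 3
    ext s
    simp only [mem_inter_iff, mem_Ioc, mem_Ici, mem_Icc]
    constructor
    · rintro ⟨⟨-, h2⟩, h3⟩; exact ⟨h3, h2⟩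
    · rintro ⟨h2, h3⟩; exact ⟨⟨ht.1.trans_le h2, h3⟩, h2⟩
  have h2 : ∀ s ∈ Ioc a b, ∫ t in Ioc a b, F (t, s) ∂P = ((Φ s - Φ a : ℝ) : ℂ) * du s := by
    intro s hs'
    have e1 : (fun t => F (t, s)) = (Iic s).indicator fun t => (K t : ℂ) * du s := by
      funext t
      by_cases h : t ≤ s <;> simp [hF, h]
    rw [e1, setIntegral_indicator measurableSet_Iic, integral_mul_const,
      ← integral_Ioc_eq_cumulative_sub hK hs'.1.le, integral_complex_ofReal]
    congr 4
    ext t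
    simp only [mem_inter_iff, mem_Ioc, mem_Iic]
    constructor
    · rintro ⟨⟨h2, -⟩, h3⟩; exact ⟨h2, h3⟩
    · rintro ⟨h2, h3⟩; exact ⟨⟨h2, h3.trans hs'.2⟩, h3⟩
  rw [setIntegral_congr_fun measurableSet_Ioc h1, setIntegral_congr_fun measurableSet_Ioc h2]
    at hswap
  have hKu : IntegrableOn (fun t => (K t : ℂ) * u t) (Ioc a b) P := by
    obtain ⟨C, hC⟩ := isCompact_Icc.exists_bound_of_continuousOn (hu.continuous.continuousOn
      (s := Icc a b))
    refine Integrable.mul_bdd (c := C) hK' hu.continuous.aestronglyMeasurable ?_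
    exact (ae_restrict_iff' measurableSet_Ioc).2
      (Filter.Eventually.of_forall fun t ht => hC t (Ioc_subset_Icc_self ht))
  have hΦm : Integrable (fun s => (Φ s : ℂ) * du s) (volume.restrict (Ioc a b)) := by
    have hΦI : ∀ x, |Φ x| ≤ ∫ t, |K t| ∂P := fun x =>
      (norm_integral_le_integral_norm _).trans
        (setIntegral_le_integral hK.norm (Filter.Eventually.of_forall fun _ => norm_nonneg _))
    have hΦs : Measurable Φ := by
      -- Here `K` has no sign. Measurability comes from writing `Φ` as a difference of monotone
      -- functions.
      have e : Φ = fun x => (∫ t in Iic x, max (K t) 0 ∂P) - ∫ t in Iic x, max (-K t) 0 ∂P := by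
        funext x
        rw [← integral_sub hK.pos_part.restrict hK.neg_part.restrict]
        refine integral_congr_ae (Filter.Eventually.of_forall fun t => ?_)
        exact (max_zero_sub_eq_self (K t)).symm
      rw [e]
      exact (variationBound_cumulative hK.pos_part fun _ => le_max_right _ _).measurable.sub
        (variationBound_cumulative hK.neg_part fun _ => le_max_right _ _).measurable
    refine hdu.bdd_mul (c := ∫ t, |K t| ∂P)
      (Complex.measurable_ofReal.comp hΦs).aestronglyMeasurable
      (Filter.Eventually.of_forall fun x => ?_)
    rw [Complex.norm_real]; exact hΦI x
  have e1 : ∫ t in Ioc a b, (K t : ℂ) * (u b - u t) ∂P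
      = ((Φ b - Φ a : ℝ) : ℂ) * u b - ∫ t in Ioc a b, (K t : ℂ) * u t ∂P := by
    simp_rw [mul_sub]
    rw [integral_sub (hK'.mul_const _) hKu, integral_mul_const, integral_complex_ofReal,
      integral_Ioc_eq_cumulative_sub hK hab]
  have e2 : ∫ s in Ioc a b, ((Φ s - Φ a : ℝ) : ℂ) * du s
      = (∫ x in a..b, (Φ x : ℂ) * du x) - (Φ a : ℂ) * (u b - u a) := by
    simp_rw [Complex.ofReal_sub, sub_mul]
    rw [integral_sub hΦm (hdu.const_mul _), integral_const_mul, hu.sub_eq,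
      intervalIntegral.integral_of_le hab, intervalIntegral.integral_of_le hab]
  rw [e1, e2] at hswap
  push_cast at hswap
  linear_combination -hswap

end DistributionFunction

/-! ### Weak derivatives and primitives. -/

theorem IsPrimitive.integral_deriv_mul_eq {U dU : ℝ → ℂ} (h : IsPrimitive U dU) {ψ : ℝ → ℝ}
    (hψ : ContDiff ℝ ∞ ψ) (hc : HasCompactSupport ψ) :
    ∫ x, ((deriv ψ x : ℝ) : ℂ) * U x = - ∫ x, ((ψ x : ℝ) : ℂ) * dU x := by
  have hψ1 : Continuous (deriv ψ) := hψ.continuous_deriv (by simp)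
  have hcc : HasCompactSupport fun x => ((ψ x : ℝ) : ℂ) :=
    hc.comp_left (g := Complex.ofReal) Complex.ofReal_zero
  have hcd : HasCompactSupport fun x => ((deriv ψ x : ℝ) : ℂ) :=
    hc.deriv.comp_left (g := Complex.ofReal) Complex.ofReal_zero
  have hP : IsPrimitive (fun x => ((ψ x : ℝ) : ℂ)) (fun x => ((deriv ψ x : ℝ) : ℂ)) := by
    refine IsPrimitive.of_hasDerivAt_off_countable (s := ∅) countable_empty ?_ (fun x _ => ?_) ?_
    · exact Complex.continuous_ofReal.comp hψ.continuous
    · exact ((hψ.differentiable (by simp)) x).hasDerivAt.ofReal_comp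
    · exact (Complex.continuous_ofReal.comp hψ1).locallyIntegrable
  have i1 : Integrable (fun x => ((deriv ψ x : ℝ) : ℂ) * U x) volume :=
    h.continuous.locallyIntegrable.integrable_smul_left_of_hasCompactSupport
      (Complex.continuous_ofReal.comp hψ1) hcd
  have i2 : Integrable (fun x => ((ψ x : ℝ) : ℂ) * dU x) volume :=
    h.locallyIntegrable.integrable_smul_left_of_hasCompactSupport
      (Complex.continuous_ofReal.comp hψ.continuous) hcc
  have i3 : Integrable (fun x => ((ψ x : ℝ) : ℂ) * U x) volume :=
    h.continuous.locallyIntegrable.integrable_smul_left_of_hasCompactSupport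
      (Complex.continuous_ofReal.comp hψ.continuous) hcc
  have := (hP.mul h).integral_eq_zero i3 (i1.add i2)
  rw [integral_add i1 i2] at this
  exact eq_neg_of_add_eq_zero_left this

theorem IsPrimitive.hasWeakDeriv {v U dU : ℝ → ℂ} (h : IsPrimitive U dU) (hv : v =ᵐ[volume] U) :
    HasWeakDeriv v dU := by
  refine ⟨h.continuous.locallyIntegrable.congr hv.symm, h.locallyIntegrable, fun ψ hψ hc => ?_⟩
  rw [← h.integral_deriv_mul_eq hψ hc]
  refine integral_congr_ae ?_
  filter_upwards [hv] with x hx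
  rw [hx]

/-- A continuous function with vanishing distributional derivative is constant. -/
theorem eq_of_forall_integral_deriv_mul_eq_zero {D : ℝ → ℂ} (hD : Continuous D)
    (h : ∀ ψ : ℝ → ℝ, ContDiff ℝ ∞ ψ → HasCompactSupport ψ →
      ∫ x, ((deriv ψ x : ℝ) : ℂ) * D x = 0) (x y : ℝ) : D x = D y := by
  let φ : ℕ → ContDiffBump (0 : ℝ) := fun n =>
    ⟨1 / (2 * ((n : ℝ) + 1)), 1 / ((n : ℝ) + 1), by positivity, by
      apply one_div_lt_one_div_of_lt <;> [positivity; linarith [n.cast_nonneg (α := ℝ)]]⟩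
  have hφ : Filter.Tendsto (fun n => (φ n).rOut) Filter.atTop (nhds 0) :=
    tendsto_one_div_add_atTop_nhds_zero_nat
  have hlim := fun x => ContDiffBump.convolution_tendsto_right_of_continuous (μ := volume) hφ hD x
  have hconst : ∀ n x y,
      convolution ((φ n).normed volume) D (ContinuousLinearMap.lsmul ℝ ℝ) volume x =
      convolution ((φ n).normed volume) D (ContinuousLinearMap.lsmul ℝ ℝ) volume y := by
    intro n
    have hs : ContDiff ℝ ∞ ((φ n).normed volume) := (φ n).contDiff_normed
    have hcs : HasCompactSupport ((φ n).normed volume) := (φ n).hasCompactSupport_normed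
    have hder : ∀ x, HasDerivAt
        (convolution ((φ n).normed volume) D (ContinuousLinearMap.lsmul ℝ ℝ) volume) 0 x := by
      intro x
      have h1 := hcs.hasDerivAt_convolution_left (ContinuousLinearMap.lsmul ℝ ℝ)
        (hs.of_le (by simp)) hD.locallyIntegrable (μ := volume) x
      have h2 : convolution (deriv ((φ n).normed volume)) D (ContinuousLinearMap.lsmul ℝ ℝ)
          volume x = 0 := by
        rw [convolution_eq_swap]
        -- The mollified function has derivative equal to the pairing of `D` with the derivative of
        -- the bump reflected about `x`. The minus sign compensates the one from the chain rule.
        have h3 := h (fun t => -(φ n).normed volume (x - t)) (by fun_prop)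
          ((hcs.comp_homeomorph (Homeomorph.subLeft x)).neg)
        have h4 : ∀ t, deriv (fun t => -(φ n).normed volume (x - t)) t =
            deriv ((φ n).normed volume) (x - t) := by
          intro t
          have := ((hs.differentiable (by simp)) (x - t)).hasDerivAt.comp_const_sub x t
          simpa using! this.neg.deriv
        simp_rw [h4] at h3
        simpa using! h3
      rwa [h2] at h1
    exact fun x y => is_const_of_deriv_eq_zero (fun x => (hder x).differentiableAt)
      (fun x => (hder x).deriv) x y
  refine tendsto_nhds_unique (hlim x) ?_
  simp_rw [fun n => hconst n x y]
  exact hlim y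

/-- The difference between `vc` and the integral of `dv` is continuous with zero distributional
derivative, hence constant. -/
theorem HasWeakDeriv.isPrimitive {v dv vc : ℝ → ℂ} (h : HasWeakDeriv v dv) (hvc : Continuous vc)
    (hv : v =ᵐ[volume] vc) : IsPrimitive vc dv := by
  have hU := isPrimitive_intervalIntegral h.2.1 0
  have hconst := eq_of_forall_integral_deriv_mul_eq_zero
    (D := fun x => vc x - ∫ t in (0 : ℝ)..x, dv t) (hvc.sub hU.continuous) (fun ψ hψ hc => by
      have hψ1 : Continuous (deriv ψ) := hψ.continuous_deriv (by simp)
      have hcd : HasCompactSupport fun x => ((deriv ψ x : ℝ) : ℂ) :=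
        hc.deriv.comp_left (g := Complex.ofReal) Complex.ofReal_zero
      simp_rw [mul_sub]
      rw [integral_sub, hU.integral_deriv_mul_eq hψ hc, ← h.2.2 ψ hψ hc, sub_eq_zero]
      · refine integral_congr_ae ?_
        filter_upwards [hv] with x hx
        rw [hx]
      · exact hvc.locallyIntegrable.integrable_smul_left_of_hasCompactSupport
          (Complex.continuous_ofReal.comp hψ1) hcd
      · exact hU.continuous.locallyIntegrable.integrable_smul_left_of_hasCompactSupport
          (Complex.continuous_ofReal.comp hψ1) hcd)
  refine ⟨h.2.1, fun a b => ?_⟩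
  rw [← hU.sub_eq]
  linear_combination hconst b a

theorem IsPrimitive.of_le {E : Type*} [NormedAddCommGroup E] [NormedSpace ℝ E] {F f : ℝ → E}
    (hf : LocallyIntegrable f volume) (h : ∀ a b, a ≤ b → F b - F a = ∫ x in a..b, f x) :
    IsPrimitive F f := by
  refine ⟨hf, fun a b => ?_⟩
  rcases le_total a b with hab | hab
  · exact h a b hab
  · rw [intervalIntegral.integral_symm, ← h b a hab, neg_sub]

theorem rightLim_ae_eq {g : ℝ → ℂ} (hg : LocallyBoundedVariationOn g univ) :
    Function.rightLim g =ᵐ[volume] g := by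
  filter_upwards [hg.ae_differentiableAt] with x hx
  exact rightLim_eq_of_tendsto (hx.continuousAt.tendsto.mono_left nhdsWithin_le_nhds)

theorem locallyIntegrable_of_memLp_two {f : ℝ → ℂ} (hf : MemLp f 2 volume) :
    LocallyIntegrable f volume := hf.locallyIntegrable (by norm_num)

/-! ### The first order system with regularized flux. -/

/-- The first order system satisfied by a function `u` in the domain with image `f`, and its
regularized flux `η`. -/
structure IsFluxSystem (c : Coeffs) (h : ℝ) (w κ : ℝ → ℝ) (f u du η dη : ℝ → ℂ) : Prop where
  prim : IsPrimitive u du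
  prim_flux : IsPrimitive η dη
  memLp : MemLp u 2 volume
  memLp_deriv : MemLp du 2 volume
  memLp_image : MemLp f 2 volume
  flux_eq : ∀ᵐ x, (h : ℂ) * c.α x * du x + Complex.I * c.b x * u x = η x + w x * u x
  deriv_flux_eq : ∀ᵐ x, dη x = (((h * c.β x)⁻¹ : ℝ) : ℂ) *
      ((h : ℂ) * c.β x * c.b x * (-Complex.I * du x) + u x * c.V₁ x - f x)
      - w x * du x + κ x * u x

namespace Coeffs.Admissible

variable {c : Coeffs}

theorem locallyIntegrable_b_mul (hc : c.Admissible) {f : ℝ → ℂ} (hf : MemLp f 2 volume) :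
    LocallyIntegrable (fun x => (c.b x : ℂ) * f x) volume := by
  obtain ⟨N, hN⟩ := hc.b₁_bv.exists_variationBound
  obtain ⟨C, hC0, hC⟩ := hN.exists_abs_le
  have h1 : Integrable (fun x => (c.b₀ x : ℂ) * f x) volume :=
    hc.b₀_memLp_two.ofReal.integrable_mul hf
  have h2 : LocallyIntegrable (fun x => (c.b₁ x : ℂ) * f x) volume := by
    refine ((locallyIntegrable_of_memLp_two hf).smul C).mono
      ((Complex.measurable_ofReal.comp hN.measurable).aestronglyMeasurable.mul hf.1) ?_
    refine Filter.Eventually.of_forall fun x => ?_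
    simp only [Pi.smul_apply, norm_mul, norm_smul, Complex.norm_real]
    gcongr
    exact (hC x).trans (le_abs_self C)
  refine (h1.locallyIntegrable.add h2).congr (Filter.Eventually.of_forall fun x => ?_)
  simp only [Pi.add_apply, Coeffs.b]
  push_cast
  ring

end Coeffs.Admissible

theorem _root_.MeasureTheory.LocallyIntegrable.bdd_mul_real {f : ℝ → ℂ}
    (hf : LocallyIntegrable f volume) {k : ℝ → ℝ} (hk : Measurable k) {C : ℝ} (hC : ∀ x, |k x| ≤ C) :
    LocallyIntegrable (fun x => (k x : ℂ) * f x) volume := by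
  refine (hf.smul C).mono
    ((Complex.measurable_ofReal.comp hk).aestronglyMeasurable.mul hf.aestronglyMeasurable) ?_
  refine Filter.Eventually.of_forall fun x => ?_
  simp only [Pi.smul_apply, norm_mul, norm_smul, Complex.norm_real]
  gcongr
  exact (hC x).trans (le_abs_self C)

/-- This is the measure equation solved for `dg`. The division by `hβ` is done for measures because
`β`, `g` and `V₀` may jump at the same points. -/
theorem increment_rightLim_eq {c : Coeffs} (hc : c.Admissible) {h : ℝ} (hh : 0 < h)
    {f dv vc g : ℝ → ℂ} (hg : LocallyBoundedVariationOn g univ)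
    (hdv : MemLp dv 2 volume) (hvc : Continuous vc) (hf : MemLp f 2 volume)
    (H : ∀ (r : ℝ) (A : Set ℝ), MeasurableSet A → A ⊆ Ioo (-r) r →
      (-h : ℂ) * (∫ᵛ x in A, c.β x ∂•(dMeasure hg r))
        + (∫ x in A, (h : ℂ) * c.β x * c.b x * (-Complex.I * dv x))
        + ((∫ᵛ x in A, vc x ∂<•c.V₀) + ∫ x in A, vc x * c.V₁ x)
      = ∫ x in A, f x) {ρ : ℝ → ℂ}
    (hρ : ρ = fun x => (h : ℂ) * c.β x * c.b x * (-Complex.I * dv x) + vc x * c.V₁ x - f x)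
    {a b : ℝ} (hab : a ≤ b) :
    LocallyIntegrable ρ volume ∧ Function.rightLim g b - Function.rightLim g a
      = (∫ x in Ioc a b, (((h * c.β x)⁻¹ : ℝ) : ℂ) * ρ x)
        + ((∫ x in Ioc a b, (((h * c.β x)⁻¹ : ℝ) : ℂ) * vc x ∂c.V₀.toJordanDecomposition.posPart)
        - ∫ x in Ioc a b, (((h * c.β x)⁻¹ : ℝ) : ℂ) * vc x ∂c.V₀.toJordanDecomposition.negPart) := by
  obtain ⟨m, hm, hβm⟩ := hc.β_lower
  obtain ⟨Nβ, hNβ⟩ := hc.β_bv.exists_variationBound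
  obtain ⟨Cβ, hCβ0, hCβ⟩ := hNβ.exists_abs_le
  obtain ⟨NV, hNV⟩ := hc.V₁_bv.exists_variationBound
  obtain ⟨CV, hCV0, hCV⟩ := hNV.exists_abs_le
  have l1 : LocallyIntegrable
      (fun x => (h : ℂ) * c.β x * c.b x * (-Complex.I * dv x)) volume := by
    have := ((hc.locallyIntegrable_b_mul hdv).bdd_mul_real hNβ.measurable hCβ).smul
      (-Complex.I * h)
    refine this.congr (Filter.Eventually.of_forall fun x => ?_)
    simp only [Pi.smul_apply, smul_eq_mul]
    ring
  have l2 : LocallyIntegrable (fun x => vc x * c.V₁ x) volume := by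
    refine (hvc.locallyIntegrable.bdd_mul_real hNV.measurable hCV).congr
      (Filter.Eventually.of_forall fun x => ?_)
    exact mul_comm _ _
  have l3 := locallyIntegrable_of_memLp_two hf
  have hρl : LocallyIntegrable ρ volume := by
    rw [hρ]; exact (l1.add l2).sub l3
  refine ⟨hρl, ?_⟩
  -- The extra 1 puts `Ioc a b`, including `b`, strictly inside the window where `dMeasure` agrees
  -- with `dg`.
  set r := |a| + |b| + 1 with hr
  have har : -r ≤ a := by linarith [neg_abs_le a, abs_nonneg b]
  have hbr : b < r := by linarith [le_abs_self b, abs_nonneg a]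
  rw [← dMeasure_Ioc hg har hab hbr]
  have hbdd : ∀ {ν : Measure ℝ} [IsFiniteMeasure ν], Integrable vc (ν.restrict (Ioc a b)) := by
    intro ν _
    exact (hvc.integrableOn_Icc (μ := ν)).mono_set Ioc_subset_Icc_self
  have hli : ∀ {F : ℝ → ℂ}, LocallyIntegrable F volume →
      Integrable F (volume.restrict (Ioc a b)) := fun hF =>
    (hF.integrableOn_isCompact isCompact_Icc).mono_set Ioc_subset_Icc_self
  have hfin := apply_univ_eq_integral_div (m := (dMeasure hg r).restrict (Ioc a b))
    (μ := volume.restrict (Ioc a b)) (P := c.V₀.toJordanDecomposition.posPart.restrict (Ioc a b))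
    (N := c.V₀.toJordanDecomposition.negPart.restrict (Ioc a b)) (ρ := ρ) (u := vc)
    (β := fun x => h * c.β x) (a := h * m) (C := h * Cβ) (mul_pos hh hm)
    (hNβ.measurable.const_mul h) (fun x => mul_le_mul_of_nonneg_left (hβm x) hh.le)
    (fun x => mul_le_mul_of_nonneg_left ((le_abs_self _).trans (hCβ x)) hh.le)
    (hli hρl) hbdd hbdd (fun A hA => ?_)
  · rwa [VectorMeasure.restrict_apply _ measurableSet_Ioc MeasurableSet.univ, univ_inter] at hfin
  · rw [VectorMeasure.restrict_restrict _ hA measurableSet_Ioc, Measure.restrict_restrict hA,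
      Measure.restrict_restrict hA, Measure.restrict_restrict hA]
    have hA' : MeasurableSet (A ∩ Ioc a b) := hA.inter measurableSet_Ioc
    have hsub : A ∩ Ioc a b ⊆ Ioc a b := inter_subset_right
    have hsub' : A ∩ Ioc a b ⊆ Ioo (-r) r := fun x hx =>
      ⟨har.trans_lt hx.2.1, hx.2.2.trans_lt hbr⟩
    have key := H r _ hA' hsub'
    rw [setIntegral_signedMeasure_eq_sub c.V₀ hA'
      (IntegrableOn.mono_set hbdd hsub) (IntegrableOn.mono_set hbdd hsub)] at key
    have e1 : ∫ᵛ x in A ∩ Ioc a b, h * c.β x ∂•(dMeasure hg r)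
        = (h : ℂ) * ∫ᵛ x in A ∩ Ioc a b, c.β x ∂•(dMeasure hg r) := by
      rw [← Complex.real_smul, ← VectorMeasure.integral_fun_smul]
      rfl
    have i1 := IntegrableOn.mono_set (hli l1) hsub
    have i2 := IntegrableOn.mono_set (hli l2) hsub
    have i3 := IntegrableOn.mono_set (hli l3) hsub
    have e2 : ∫ x in A ∩ Ioc a b, ρ x
        = (∫ x in A ∩ Ioc a b, (h : ℂ) * c.β x * c.b x * (-Complex.I * dv x))
          + (∫ x in A ∩ Ioc a b, vc x * c.V₁ x) - ∫ x in A ∩ Ioc a b, f x := by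
      rw [← integral_add i1 i2, hρ]
      exact integral_sub (i1.add i2) i3
    rw [e1, e2]
    linear_combination -key

/-- The flux is `η = g⁺ - Φu + (average Φ)u`. Subtracting `Φu` cancels the jumps caused by `V₀`, and
adding the average makes the discrepancy between `g` and `η` integrable. The functions `w`, `κ` and
`p` are fixed before `v`, which makes the later constants uniform. -/
theorem exists_isFluxSystem {c : Coeffs} (hc : c.Admissible) {h : ℝ} (hh : 0 < h) :
    ∃ (w κ p : ℝ → ℝ) (Cw : ℝ), Measurable w ∧ Measurable κ ∧ Integrable p volume ∧
      (∀ x, |w x| ≤ p x) ∧ (∀ x, |κ x| ≤ p x) ∧ (∀ x, |w x| ≤ Cw) ∧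
      ∀ v f, IsImage c h v f → ∃ u du η dη : ℝ → ℂ, v =ᵐ[volume] u ∧
        IsFluxSystem c h w κ f u du η dη := by
  obtain ⟨m, hm, hβm⟩ := hc.β_lower
  obtain ⟨Nβ, hNβ⟩ := hc.β_bv.exists_variationBound
  obtain ⟨NV, hNV⟩ := hc.V₁_bv.exists_variationBound
  set P := c.V₀.toJordanDecomposition.posPart with hP
  set N := c.V₀.toJordanDecomposition.negPart with hN
  set K : ℝ → ℝ := fun x => (h * c.β x)⁻¹ with hK
  have hKm : Measurable K := (hNβ.measurable.const_mul h).inv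
  have hβ0 : ∀ x, 0 < h * c.β x := fun x => mul_pos hh (hm.trans_le (hβm x))
  have hK0 : ∀ x, 0 ≤ K x := fun x => inv_nonneg.2 (hβ0 x).le
  have hKb : ∀ x, |K x| ≤ (h * m)⁻¹ := fun x => by
    rw [abs_of_nonneg (hK0 x)]
    exact inv_anti₀ (mul_pos hh hm) (mul_le_mul_of_nonneg_left (hβm x) hh.le)
  have hKi : ∀ (ν : Measure ℝ) [IsFiniteMeasure ν], Integrable K ν := fun ν _ =>
    Integrable.of_bound hKm.aestronglyMeasurable _ (Filter.Eventually.of_forall hKb)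
  have hVP := variationBound_cumulative (hKi P) hK0
  have hVN := variationBound_cumulative (hKi N) hK0
  have hΦ := hVP.add (hVN.const_mul (-1))
  set Φ := fun x => cumulative P K x + -1 * cumulative N K x with hΦdef
  set M := fun x => cumulative P K x + |(-1 : ℝ)| * cumulative N K x
  obtain ⟨C, hC0, hC⟩ := hΦ.exists_abs_le
  have hav := hΦ.isPrimitive_average
  have havc := hav.continuous
  -- `κ` is the derivative of `average Φ`. Both `w` and `κ` are bounded by the increment of `M`,
  -- which is integrable.
  refine ⟨fun x => Φ x - average Φ x, fun x => Φ (x + 1) - Φ x, fun x => M (x + 1) - M x, C + C,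
    hΦ.measurable.sub havc.measurable,
    (hΦ.measurable.comp (measurable_id.add_const 1)).sub hΦ.measurable,
    hΦ.integrable_increment, fun x => ?_, fun x => hΦ.abs_sub_le _ _ (by linarith), fun x => ?_, ?_⟩
  · rw [abs_sub_comm]; exact hΦ.abs_average_sub_le x
  · exact (abs_sub _ _).trans (add_le_add (hC x) (VariationBound.abs_average_le hC x))
  rintro v f ⟨dv, vc, g, hg, hv, hdv, hweak, hvc, hvvc, hgae, -, hf, H⟩
  have hprim := hweak.isPrimitive hvc hvvc
  set ρ : ℝ → ℂ := fun x => (h : ℂ) * c.β x * c.b x * (-Complex.I * dv x) + vc x * c.V₁ x - f x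
    with hρ
  have hincr := fun a b (hab : a ≤ b) => increment_rightLim_eq hc hh hg hdv hvc hf H hρ hab
  have hρl : LocallyIntegrable ρ volume := (hincr 0 0 le_rfl).1
  have hKρ : LocallyIntegrable (fun x => (K x : ℂ) * ρ x) volume := hρl.bdd_mul_real hKm hKb
  have hΦdv : LocallyIntegrable (fun x => (Φ x : ℂ) * dv x) volume :=
    hprim.locallyIntegrable.bdd_mul_real hΦ.measurable hC
  have hcum : ∀ (ν : Measure ℝ) [IsFiniteMeasure ν],
      LocallyIntegrable (fun x => (cumulative ν K x : ℂ) * dv x) volume := by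
    intro ν _
    have h1 := variationBound_cumulative (hKi ν) hK0
    obtain ⟨D, -, hD⟩ := h1.exists_abs_le
    exact hprim.locallyIntegrable.bdd_mul_real h1.measurable hD
  -- Integration by parts turns the `V₀` term into the increment of `Φ vc` minus `∫ Φ dv`, so no
  -- singular part remains.
  have hη1 : IsPrimitive (fun x => Function.rightLim g x - (Φ x : ℂ) * vc x)
      (fun x => (K x : ℂ) * ρ x - (Φ x : ℂ) * dv x) := by
    refine IsPrimitive.of_le (hKρ.sub hΦdv) fun a b hab => ?_
    have h1 := (hincr a b hab).2
    rw [hprim.setIntegral_Ioc_eq (hKi P) hab, hprim.setIntegral_Ioc_eq (hKi N) hab,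
      ← intervalIntegral.integral_of_le hab] at h1
    rw [intervalIntegral.integral_sub (hKρ.intervalIntegrable_real _ _)
      (hΦdv.intervalIntegrable_real _ _)]
    have h2 : ∫ x in a..b, (Φ x : ℂ) * dv x = (∫ x in a..b, (cumulative P K x : ℂ) * dv x)
        - ∫ x in a..b, (cumulative N K x : ℂ) * dv x := by
      rw [← intervalIntegral.integral_sub ((hcum P).intervalIntegrable_real _ _)
        ((hcum N).intervalIntegrable_real _ _)]
      refine intervalIntegral.integral_congr fun x _ => ?_
      simp only [hΦdef]
      push_cast
      ring
    rw [h2]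
    simp only [hΦdef]
    push_cast
    linear_combination h1
  have havp : IsPrimitive (fun x => ((average Φ x : ℝ) : ℂ))
      (fun x => ((Φ (x + 1) - Φ x : ℝ) : ℂ)) := hav.clm Complex.ofRealCLM
  have hη := hη1.add (havp.mul hprim)
  have hvcLp : MemLp vc 2 volume := hv.ae_eq hvvc
  refine ⟨vc, dv, _, _, hvvc, hprim, hη, hvcLp, hdv, hf, ?_,
    Filter.Eventually.of_forall fun x => ?_⟩
  · filter_upwards [hgae, hvvc, rightLim_ae_eq hg] with x h1 h2 h3
    rw [h3, h1, h2]
    push_cast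
    ring
  · simp only [hρ, hK]
    push_cast
    ring

/-! ### The energy method. -/

/-- The quantitative data of the energy method: the system
`u' = A (η + w u - i b u)`, `η' = -A (i b η + w η + W u) + q u - k (i ε u + F)`
together with an absolutely continuous weight `S` and an integrable function `p` dominating all the
error coefficients. -/
structure IsEnergySystem (A₀ A₁ k₁ Cw CW CS t₀ : ℝ) (p : ℝ → ℝ) (A k w q W S σ b : ℝ → ℝ) (ε : ℝ)
    (F u du η dη : ℝ → ℂ) : Prop where
  A₀_pos : 0 < A₀
  t₀_pos : 0 < t₀
  t₀_le : t₀ ≤ 1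
  A_bounds : ∀ x, A₀ ≤ A x ∧ A x ≤ A₁
  k_bounds : ∀ x, 0 ≤ k x ∧ k x ≤ k₁
  W_bound : ∀ x, |W x| ≤ CW
  S_bounds : ∀ x, t₀ ≤ S x ∧ S x ≤ CS
  w_bound : ∀ x, |w x| ≤ Cw
  w_le : ∀ x, |w x| ≤ p x
  q_le : ∀ x, |q x| ≤ p x
  σ_le : ∀ x, |σ x| ≤ p x
  S_sub_le : ∀ x, |S x - W x| ≤ p x
  p_int : Integrable p volume
  A_meas : AEStronglyMeasurable A volume
  k_meas : AEStronglyMeasurable k volume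
  q_meas : AEStronglyMeasurable q volume
  W_meas : AEStronglyMeasurable W volume
  S_prim : IsPrimitive S σ
  u_prim : IsPrimitive u du
  η_prim : IsPrimitive η dη
  F_memLp : MemLp F 2 volume
  u_memLp : MemLp u 2 volume
  η_memLp : MemLp η 2 volume
  du_memLp : MemLp du 2 volume
  du_eq : ∀ᵐ x, du x = A x * (η x + w x * u x - Complex.I * b x * u x)
  dη_eq : ∀ᵐ x, dη x = -(A x * (Complex.I * b x * η x + w x * η x + W x * u x)) + q x * u x
    - k x * (Complex.I * ε * u x + F x)

section Pointwise

variable {A k w q W b ε : ℝ} {F u du η dη : ℂ}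

theorem re_deriv_mul_star (h : du = A * (η + w * u - Complex.I * b * u)) :
    (du * star u).re = A * ((η * star u).re + w * ‖u‖ ^ 2) := by
  rw [h, ← Complex.normSq_eq_norm_sq, Complex.normSq_apply]
  simp
  ring

/-- The terms with `b`, `w` and `ε` all cancel in the real part, leaving an identity that controls
`‖η‖²`. -/
theorem re_deriv_flux_mul_star (h : du = A * (η + w * u - Complex.I * b * u))
    (h' : dη = -(A * (Complex.I * b * η + w * η + W * u)) + q * u - k * (Complex.I * ε * u + F)) :
    (dη * star u + η * star du).re
      = A * ‖η‖ ^ 2 - (W * A - q) * ‖u‖ ^ 2 - k * (F * star u).re := by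
  rw [h, h', ← Complex.normSq_eq_norm_sq, Complex.normSq_apply, ← Complex.normSq_eq_norm_sq,
    Complex.normSq_apply]
  simp
  ring

/-- The magnetic term is purely imaginary and drops out. The term `A W Re(η ū)` is the one that the
weight `S` in the energy must compensate. -/
theorem re_deriv_flux_mul_star_flux
    (h' : dη = -(A * (Complex.I * b * η + w * η + W * u)) + q * u - k * (Complex.I * ε * u + F)) :
    (dη * star η).re = -(A * w * ‖η‖ ^ 2) - A * W * (η * star u).re + q * (η * star u).re
      - k * (ε * (Complex.I * u * star η).re + (F * star η).re) := by
  rw [h', ← Complex.normSq_eq_norm_sq, Complex.normSq_apply]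
  simp
  ring

theorem abs_re_mul_star_le (z w : ℂ) : |(z * star w).re| ≤ ‖z‖ * ‖w‖ := by
  refine (Complex.abs_re_le_norm _).trans ?_
  rw [norm_mul, norm_star]

end Pointwise

namespace IsEnergySystem

variable {A₀ A₁ k₁ Cw CW CS t₀ : ℝ} {p : ℝ → ℝ} {A k w q W S σ b : ℝ → ℝ} {ε : ℝ}
    {F u du η dη : ℝ → ℂ}

theorem integrable_norm_sq {f : ℝ → ℂ} (hf : MemLp f 2 volume) :
    Integrable (fun x => ‖f x‖ ^ 2) volume := hf.integrable_norm_pow (by norm_num)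

theorem integrable_norm_mul_norm {f g : ℝ → ℂ} (hf : MemLp f 2 volume) (hg : MemLp g 2 volume) :
    Integrable (fun x => ‖f x‖ * ‖g x‖) volume := hf.norm.integrable_mul hg.norm

/-- Integrating `(|u|²)'` from `-∞` bounds the supremum of `u`. This is what makes sense of `∫
q|u|²` for a coefficient `q` that is merely integrable. -/
theorem norm_sq_le (H : IsEnergySystem A₀ A₁ k₁ Cw CW CS t₀ p A k w q W S σ b ε F u du η dη)
    (x : ℝ) :
    ‖u x‖ ^ 2 ≤ 2 * A₁ * (∫ t, ‖η t‖ * ‖u t‖) + 2 * A₁ * Cw * ∫ t, ‖u t‖ ^ 2 := by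
  have i1 := (integrable_norm_mul_norm H.η_memLp H.u_memLp).const_mul (2 * A₁)
  have i2 := (integrable_norm_sq H.u_memLp).const_mul (2 * A₁ * Cw)
  have hA1 : 0 ≤ A₁ := H.A₀_pos.le.trans ((H.A_bounds 0).1.trans (H.A_bounds 0).2)
  have hCw : 0 ≤ Cw := (abs_nonneg _).trans (H.w_bound 0)
  have := H.u_prim.normSq.gronwall (integrable_norm_sq H.u_memLp)
    (p := fun _ => 0) (integrable_zero _ _ _) (fun _ => le_rfl) (i1.add i2)
    (Filter.Eventually.of_forall fun t => by simp only [Pi.add_apply]; positivity)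
    (by
      filter_upwards [H.du_eq] with t ht
      rw [re_deriv_mul_star ht]
      have h1 := le_of_abs_le (abs_re_mul_star_le (η t) (u t))
      have h2 := le_of_abs_le (H.w_bound t)
      have h3 := (H.A_bounds t).2
      have h4 : 0 ≤ A t := H.A₀_pos.le.trans (H.A_bounds t).1
      have h5 : (η t * star (u t)).re + w t * ‖u t‖ ^ 2 ≤ ‖η t‖ * ‖u t‖ + Cw * ‖u t‖ ^ 2 := by
        gcongr
      have h6 : A t * ((η t * star (u t)).re + w t * ‖u t‖ ^ 2)
          ≤ A₁ * (‖η t‖ * ‖u t‖ + Cw * ‖u t‖ ^ 2) :=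
        (mul_le_mul_of_nonneg_left h5 h4).trans
          (mul_le_mul_of_nonneg_right h3 (by positivity))
      simp only [Pi.add_apply]
      linarith) x
  simp only [Pi.add_apply] at this
  rw [integral_add i1 i2, integral_const_mul, integral_const_mul] at this
  simpa using this

theorem integrable_coeff_mul
    (H : IsEnergySystem A₀ A₁ k₁ Cw CW CS t₀ p A k w q W S σ b ε F u du η dη)
    {r : ℝ → ℝ} (hr : AEStronglyMeasurable r volume) (hrp : ∀ x, |r x| ≤ p x) :
    Integrable (fun x => r x * ‖u x‖ ^ 2) volume := by
  have hri : Integrable r volume := H.p_int.mono' hr (Filter.Eventually.of_forall hrp)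
  refine hri.mul_bdd (c := 2 * A₁ * (∫ t, ‖η t‖ * ‖u t‖) + 2 * A₁ * Cw * ∫ t, ‖u t‖ ^ 2)
    (H.u_prim.continuous.norm.pow 2).aestronglyMeasurable
    (Filter.Eventually.of_forall fun x => ?_)
  rw [Real.norm_of_nonneg (by positivity)]
  exact H.norm_sq_le x

/-- The constant in front of `‖u‖²` in the estimate of `‖η‖²`. -/
def fluxConst (A₀ A₁ k₁ Cw CW : ℝ) (p : ℝ → ℝ) : ℝ :=
  2 * (CW * A₁ + 2 * A₁ * Cw * (∫ x, p x) + 2 * (A₁ * ∫ x, p x) ^ 2 / A₀ + k₁ / 2) / A₀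

/-- The derivative of `Re(η ū)` integrates to zero over the line, so `∫ A|η|²` equals terms in
`|u|²` and `F ū`. The `q` term is bounded through `norm_sq_le`. -/
theorem integral_flux_sq_le
    (H : IsEnergySystem A₀ A₁ k₁ Cw CW CS t₀ p A k w q W S σ b ε F u du η dη) :
    ∫ x, ‖η x‖ ^ 2 ≤ fluxConst A₀ A₁ k₁ Cw CW p * (∫ x, ‖u x‖ ^ 2) + k₁ / A₀ * ∫ x, ‖F x‖ ^ 2 := by
  have hA₀ := H.A₀_pos
  have hA1 : 0 ≤ A₁ := H.A₀_pos.le.trans ((H.A_bounds 0).1.trans (H.A_bounds 0).2)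
  have hk1 : 0 ≤ k₁ := (H.k_bounds 0).1.trans (H.k_bounds 0).2
  have hCw : 0 ≤ Cw := (abs_nonneg _).trans (H.w_bound 0)
  have hCW : 0 ≤ CW := (abs_nonneg _).trans (H.W_bound 0)
  have hp0 : ∀ x, 0 ≤ p x := fun x => (abs_nonneg _).trans (H.w_le x)
  have iη := integrable_norm_sq H.η_memLp
  have iu := integrable_norm_sq H.u_memLp
  have iF := integrable_norm_sq H.F_memLp
  have iηu := integrable_norm_mul_norm H.η_memLp H.u_memLp
  have iFu := integrable_norm_mul_norm H.F_memLp H.u_memLp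
  have hAn : ∀ x, ‖A x‖ ≤ A₁ := fun x => by
    rw [Real.norm_of_nonneg (hA₀.le.trans (H.A_bounds x).1)]; exact (H.A_bounds x).2
  have j1 : Integrable (fun x => A x * ‖η x‖ ^ 2) volume :=
    iη.bdd_mul (c := A₁) H.A_meas (Filter.Eventually.of_forall hAn)
  have j2 : Integrable (fun x => W x * A x * ‖u x‖ ^ 2) volume := by
    refine iu.bdd_mul (c := CW * A₁) (H.W_meas.mul H.A_meas)
      (Filter.Eventually.of_forall fun x => ?_)
    rw [norm_mul]
    exact mul_le_mul (H.W_bound x) (hAn x) (norm_nonneg _) hCW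
  have j3 := H.integrable_coeff_mul H.q_meas H.q_le
  have j4 : Integrable (fun x => k x * (F x * star (u x)).re) volume := by
    have h1 : Integrable (fun x => (F x * star (u x)).re) volume :=
      (H.F_memLp.integrable_mul H.u_memLp.star).re
    refine h1.bdd_mul (c := k₁) H.k_meas (Filter.Eventually.of_forall fun x => ?_)
    rw [Real.norm_of_nonneg (H.k_bounds x).1]; exact (H.k_bounds x).2
  have hstar : IsPrimitive (fun x => star (u x)) (fun x => star (du x)) :=
    H.u_prim.clm (Complex.conjCLE : ℂ →L[ℝ] ℂ)
  have hprim := (H.η_prim.mul hstar).clm Complex.reCLM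
  have hprim' := hprim.congr_deriv (g := fun x => A x * ‖η x‖ ^ 2
      - (W x * A x * ‖u x‖ ^ 2 - q x * ‖u x‖ ^ 2) - k x * (F x * star (u x)).re) (by
    filter_upwards [H.du_eq, H.dη_eq] with x h1 h2
    rw [Complex.reCLM_apply, re_deriv_flux_mul_star h1 h2]
    ring)
  have hzero := hprim'.integral_eq_zero (H.η_memLp.integrable_mul H.u_memLp.star).re
    ((j1.sub (j2.sub j3)).sub j4)
  set U := 2 * A₁ * (∫ t, ‖η t‖ * ‖u t‖) + 2 * A₁ * Cw * ∫ t, ‖u t‖ ^ 2 with hU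
  have hle : A₀ * (∫ x, ‖η x‖ ^ 2) ≤ CW * A₁ * (∫ x, ‖u x‖ ^ 2) + U * (∫ x, p x)
      + k₁ / 2 * ((∫ x, ‖F x‖ ^ 2) + ∫ x, ‖u x‖ ^ 2) := by
    have e1 : ∫ x, (A x * ‖η x‖ ^ 2
      - (W x * A x * ‖u x‖ ^ 2 - q x * ‖u x‖ ^ 2) - k x * (F x * star (u x)).re) ≥
      ∫ x, (A₀ * ‖η x‖ ^ 2 - (CW * A₁ * ‖u x‖ ^ 2 + U * p x)
        - k₁ / 2 * (‖F x‖ ^ 2 + ‖u x‖ ^ 2)) := by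
      refine integral_mono (((iη.const_mul _).sub ((iu.const_mul _).add (H.p_int.const_mul _))).sub
        ((iF.add iu).const_mul _)) ((j1.sub (j2.sub j3)).sub j4) fun x => ?_
      have b1 : A₀ * ‖η x‖ ^ 2 ≤ A x * ‖η x‖ ^ 2 := by gcongr; exact (H.A_bounds x).1
      have b2 : W x * A x * ‖u x‖ ^ 2 ≤ CW * A₁ * ‖u x‖ ^ 2 := by
        refine mul_le_mul_of_nonneg_right ?_ (sq_nonneg _)
        calc W x * A x ≤ |W x * A x| := le_abs_self _
          _ = |W x| * ‖A x‖ := abs_mul _ _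
          _ ≤ CW * A₁ := mul_le_mul (H.W_bound x) (hAn x) (norm_nonneg _) hCW
      have b3 : -(q x * ‖u x‖ ^ 2) ≤ U * p x := by
        calc -(q x * ‖u x‖ ^ 2) ≤ |q x| * ‖u x‖ ^ 2 := by
              rw [← neg_mul]; gcongr; exact neg_le_abs _
          _ ≤ p x * U := mul_le_mul (H.q_le x) (H.norm_sq_le x) (by positivity) (hp0 x)
          _ = _ := mul_comm _ _
      have b4 : k x * (F x * star (u x)).re ≤ k₁ / 2 * (‖F x‖ ^ 2 + ‖u x‖ ^ 2) := by
        calc k x * (F x * star (u x)).re ≤ k x * (‖F x‖ * ‖u x‖) :=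
              mul_le_mul_of_nonneg_left (le_of_abs_le (abs_re_mul_star_le _ _)) (H.k_bounds x).1
          _ ≤ k₁ * (‖F x‖ * ‖u x‖) := by gcongr; exact (H.k_bounds x).2
          _ ≤ k₁ * ((‖F x‖ ^ 2 + ‖u x‖ ^ 2) / 2) := by
              gcongr; linarith [two_mul_le_add_sq ‖F x‖ ‖u x‖]
          _ = _ := by ring
      dsimp only
      linarith
    have i1 : Integrable (fun x => CW * A₁ * ‖u x‖ ^ 2 + U * p x) volume :=
      (iu.const_mul _).add (H.p_int.const_mul _)
    have i2 : Integrable (fun x => A₀ * ‖η x‖ ^ 2 - (CW * A₁ * ‖u x‖ ^ 2 + U * p x)) volume :=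
      (iη.const_mul _).sub i1
    have i3 : Integrable (fun x => k₁ / 2 * (‖F x‖ ^ 2 + ‖u x‖ ^ 2)) volume :=
      (iF.add iu).const_mul _
    rw [hzero, integral_sub i2 i3, integral_sub (iη.const_mul _) i1,
      integral_add (iu.const_mul _) (H.p_int.const_mul _), integral_const_mul, integral_const_mul,
      integral_const_mul, integral_const_mul, integral_add iF iu] at e1
    linarith
  have hJ : 0 ≤ ∫ x, p x := integral_nonneg hp0
  set J := ∫ x, p x with hJdef
  -- The sup bound on `u` brings back `∫|η||u|`. Young's inequality with weight `A₀ / 2` lets half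
  -- of the left side absorb it.
  have hyoung : 2 * A₁ * (∫ t, ‖η t‖ * ‖u t‖) * J
      ≤ A₀ / 2 * (∫ x, ‖η x‖ ^ 2) + 2 * (A₁ * J) ^ 2 / A₀ * ∫ x, ‖u x‖ ^ 2 := by
    have e1 : 2 * A₁ * (∫ t, ‖η t‖ * ‖u t‖) * J = ∫ t, 2 * A₁ * J * (‖η t‖ * ‖u t‖) := by
      rw [integral_const_mul]; ring
    have e2 : A₀ / 2 * (∫ x, ‖η x‖ ^ 2) + 2 * (A₁ * J) ^ 2 / A₀ * (∫ x, ‖u x‖ ^ 2)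
        = ∫ x, (A₀ / 2 * ‖η x‖ ^ 2 + 2 * (A₁ * J) ^ 2 / A₀ * ‖u x‖ ^ 2) := by
      rw [integral_add (iη.const_mul _) (iu.const_mul _), integral_const_mul, integral_const_mul]
    rw [e1, e2]
    refine integral_mono (iηu.const_mul _) ((iη.const_mul _).add (iu.const_mul _)) fun x => ?_
    have h1 : A₀ / 2 * ‖η x‖ ^ 2 + 2 * (A₁ * J) ^ 2 / A₀ * ‖u x‖ ^ 2
        - 2 * A₁ * J * (‖η x‖ * ‖u x‖) = (A₀ * ‖η x‖ - 2 * (A₁ * J) * ‖u x‖) ^ 2 / (2 * A₀) := by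
      field_simp
      ring
    have h2 : 0 ≤ (A₀ * ‖η x‖ - 2 * (A₁ * J) * ‖u x‖) ^ 2 / (2 * A₀) := by positivity
    dsimp only
    linarith
  have hfin : A₀ / 2 * (∫ x, ‖η x‖ ^ 2)
      ≤ (CW * A₁ + 2 * A₁ * Cw * J + 2 * (A₁ * J) ^ 2 / A₀ + k₁ / 2) * (∫ x, ‖u x‖ ^ 2)
        + k₁ / 2 * ∫ x, ‖F x‖ ^ 2 := by
    rw [hU] at hle
    linarith
  unfold fluxConst
  rw [← hJdef]
  calc ∫ x, ‖η x‖ ^ 2 = 2 / A₀ * (A₀ / 2 * ∫ x, ‖η x‖ ^ 2) := by field_simp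
    _ ≤ 2 / A₀ * ((CW * A₁ + 2 * A₁ * Cw * J + 2 * (A₁ * J) ^ 2 / A₀ + k₁ / 2)
        * (∫ x, ‖u x‖ ^ 2) + k₁ / 2 * ∫ x, ‖F x‖ ^ 2) := by gcongr
    _ = _ := by ring

/-- The Grönwall rate. -/
def rate (A₁ CS t₀ : ℝ) : ℝ := (3 * A₁ + 2 + 2 * CS * A₁) / t₀

/-- Grönwall for `|η|² + S|u|²`, which is comparable to `|u|² + |η|²` from below because `t₀ ≤ S`
and `t₀ ≤ 1`. Every term of its derivative is either dominated by `p` times the energy or contains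
`ε` or `F`. -/
theorem energy_le (H : IsEnergySystem A₀ A₁ k₁ Cw CW CS t₀ p A k w q W S σ b ε F u du η dη)
    (x : ℝ) :
    ‖u x‖ ^ 2 + ‖η x‖ ^ 2 ≤ Real.exp (rate A₁ CS t₀ * ∫ t, p t) * (2 * k₁) / t₀ *
      (|ε| * (∫ t, ‖u t‖ * ‖η t‖) + ∫ t, ‖F t‖ * ‖η t‖) := by
  have ht := H.t₀_pos
  have hA1 : 0 ≤ A₁ := H.A₀_pos.le.trans ((H.A_bounds 0).1.trans (H.A_bounds 0).2)
  have hk1 : 0 ≤ k₁ := (H.k_bounds 0).1.trans (H.k_bounds 0).2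
  have hCS : 0 ≤ CS := ht.le.trans ((H.S_bounds 0).1.trans (H.S_bounds 0).2)
  have hp0 : ∀ x, 0 ≤ p x := fun x => (abs_nonneg _).trans (H.w_le x)
  have hrate : 0 ≤ rate A₁ CS t₀ := by unfold rate; positivity
  have iη := integrable_norm_sq H.η_memLp
  have iu := integrable_norm_sq H.u_memLp
  have iuη := integrable_norm_mul_norm H.u_memLp H.η_memLp
  have iFη := integrable_norm_mul_norm H.F_memLp H.η_memLp
  have hS0 : ∀ x, 0 ≤ S x := fun x => ht.le.trans (H.S_bounds x).1
  have hlow : ∀ x, t₀ * (‖u x‖ ^ 2 + ‖η x‖ ^ 2) ≤ ‖η x‖ ^ 2 + S x * ‖u x‖ ^ 2 := by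
    intro x
    have h1 : t₀ * ‖u x‖ ^ 2 ≤ S x * ‖u x‖ ^ 2 := by gcongr; exact (H.S_bounds x).1
    have h2 : t₀ * ‖η x‖ ^ 2 ≤ 1 * ‖η x‖ ^ 2 := by gcongr; exact H.t₀_le
    linarith
  have hG := H.η_prim.normSq.add (H.S_prim.mul H.u_prim.normSq)
  have hGi : Integrable (fun x => ‖η x‖ ^ 2 + S x * ‖u x‖ ^ 2) volume := by
    refine iη.add (iu.bdd_mul (c := CS) H.S_prim.continuous.aestronglyMeasurable
      (Filter.Eventually.of_forall fun x => ?_))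
    rw [Real.norm_of_nonneg (hS0 x)]; exact (H.S_bounds x).2
  have hgr := hG.gronwall hGi (p := fun x => rate A₁ CS t₀ * p x) (H.p_int.const_mul _)
    (fun x => mul_nonneg hrate (hp0 x))
    (q := fun x => 2 * k₁ * (|ε| * (‖u x‖ * ‖η x‖) + ‖F x‖ * ‖η x‖))
    (((iuη.const_mul _).add iFη).const_mul _)
    (Filter.Eventually.of_forall fun x => by positivity) (by
      filter_upwards [H.du_eq, H.dη_eq] with x h1 h2
      rw [re_deriv_mul_star h1, re_deriv_flux_mul_star_flux h2]
      have hA := H.A_bounds x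
      have hA' : 0 ≤ A x := H.A₀_pos.le.trans hA.1
      have hS := H.S_bounds x
      set X := ‖η x‖ with hX
      set Y := ‖u x‖ with hY
      have hX0 : 0 ≤ X := norm_nonneg _
      have hY0 : 0 ≤ Y := norm_nonneg _
      have hXY : X * Y ≤ (Y ^ 2 + X ^ 2) / 2 := by linarith [two_mul_le_add_sq Y X]
      have hZ : |(η x * star (u x)).re| ≤ X * Y := abs_re_mul_star_le _ _
      set Z := (η x * star (u x)).re
      have c1 : -(A x * w x * X ^ 2) ≤ A₁ * p x * X ^ 2 := by
        calc -(A x * w x * X ^ 2) = A x * (-w x) * X ^ 2 := by ring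
          _ ≤ A x * p x * X ^ 2 := by
              gcongr; exact (neg_le_abs _).trans (H.w_le x)
          _ ≤ _ := by gcongr; exacts [hp0 x, hA.2]
      -- The decisive cancellation: the cross terms from `|η|²` and `S|u|²` leave only the
      -- integrable difference `S - W`.
      have c2 : A x * (S x - W x) * Z ≤ A₁ * p x * (X * Y) := by
        calc A x * (S x - W x) * Z ≤ |A x * (S x - W x) * Z| := le_abs_self _
          _ = A x * |S x - W x| * |Z| := by rw [abs_mul, abs_mul, abs_of_nonneg hA']
          _ ≤ A₁ * p x * (X * Y) := by
            gcongr
            · exact mul_nonneg hA1 (hp0 x)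
            · exact hA.2
            · exact H.S_sub_le x
      have c3 : q x * Z ≤ p x * (X * Y) := by
        calc q x * Z ≤ |q x| * |Z| := by rw [← abs_mul]; exact le_abs_self _
          _ ≤ _ := mul_le_mul (H.q_le x) hZ (abs_nonneg _) (hp0 x)
      have c4 : -(k x * (ε * (Complex.I * u x * star (η x)).re + (F x * star (η x)).re))
          ≤ k₁ * (|ε| * (Y * X) + ‖F x‖ * X) := by
        have d1 : |(Complex.I * u x * star (η x)).re| ≤ Y * X := by
          have := abs_re_mul_star_le (Complex.I * u x) (η x)
          rwa [norm_mul, Complex.norm_I, one_mul] at this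
        have d2 : |(F x * star (η x)).re| ≤ ‖F x‖ * X := abs_re_mul_star_le _ _
        calc -(k x * (ε * (Complex.I * u x * star (η x)).re + (F x * star (η x)).re))
            ≤ |k x * (ε * (Complex.I * u x * star (η x)).re + (F x * star (η x)).re)| :=
              neg_le_abs _
          _ = k x * |ε * (Complex.I * u x * star (η x)).re + (F x * star (η x)).re| := by
              rw [abs_mul, abs_of_nonneg (H.k_bounds x).1]
          _ ≤ k x * (|ε| * (Y * X) + ‖F x‖ * X) := by
              refine mul_le_mul_of_nonneg_left ((abs_add_le _ _).trans ?_) (H.k_bounds x).1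
              rw [abs_mul]
              gcongr
          _ ≤ _ := by gcongr; exact (H.k_bounds x).2
      have c5 : σ x * Y ^ 2 ≤ p x * Y ^ 2 := by
        gcongr; exact (le_abs_self _).trans (H.σ_le x)
      have c6 : S x * A x * (w x * Y ^ 2) ≤ CS * A₁ * (p x * Y ^ 2) := by
        calc S x * A x * (w x * Y ^ 2) ≤ S x * A x * (p x * Y ^ 2) := by
              have : 0 ≤ S x * A x := mul_nonneg (hS0 x) hA'
              gcongr
              exact (le_abs_self _).trans (H.w_le x)
          _ ≤ _ := by
              have : 0 ≤ p x * Y ^ 2 := mul_nonneg (hp0 x) (sq_nonneg _)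
              gcongr
              exacts [hS.2, hA.2]
      -- The numerator of `rate` bounds the sum of the coefficients of `X²` and of `Y²` in the
      -- preceding estimates, after replacing `XY` by `(X² + Y²)/2`.
      have c7 : p x * ((3 * A₁ + 2 + 2 * CS * A₁) * (Y ^ 2 + X ^ 2))
          ≤ rate A₁ CS t₀ * p x * (X ^ 2 + S x * Y ^ 2) := by
        have := hlow x
        calc p x * ((3 * A₁ + 2 + 2 * CS * A₁) * (Y ^ 2 + X ^ 2))
            = rate A₁ CS t₀ * p x * (t₀ * (Y ^ 2 + X ^ 2)) := by
              unfold rate; field_simp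
          _ ≤ _ := mul_le_mul_of_nonneg_left this (mul_nonneg hrate (hp0 x))
      have c8 : A₁ * p x * (X * Y) ≤ A₁ * p x * ((Y ^ 2 + X ^ 2) / 2) :=
        mul_le_mul_of_nonneg_left hXY (mul_nonneg hA1 (hp0 x))
      have c9 : p x * (X * Y) ≤ p x * ((Y ^ 2 + X ^ 2) / 2) :=
        mul_le_mul_of_nonneg_left hXY (hp0 x)
      have c10 : 0 ≤ CS * A₁ * (p x * X ^ 2) :=
        mul_nonneg (mul_nonneg hCS hA1) (mul_nonneg (hp0 x) (sq_nonneg _))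
      have c11 : 0 ≤ p x * X ^ 2 := mul_nonneg (hp0 x) (sq_nonneg _)
      have c12 : 0 ≤ A₁ * (p x * Y ^ 2) := mul_nonneg hA1 (mul_nonneg (hp0 x) (sq_nonneg _))
      linarith) x
  rw [integral_const_mul, integral_const_mul, integral_add (iuη.const_mul _) iFη,
    integral_const_mul] at hgr
  have h1 := (hlow x).trans hgr
  rw [div_mul_eq_mul_div, le_div_iff₀ ht]
  linarith

/-- The bound `M` is finite since all functions are in `L²`, so the share `M / 2` of `∫|F||η|` can
be moved to the left. The factor `|ε|` in front of `‖η‖₂²` is kept for `‖u‖₂²` and replaced by `ε₀`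
for `F`. -/
theorem energy_le_weighted
    (H : IsEnergySystem A₀ A₁ k₁ Cw CW CS t₀ p A k w q W S σ b ε F u du η dη)
    {θ : ℝ → ℝ} (hθ1 : ∀ x, 1 ≤ θ x) (hθi : Integrable (fun x => (θ x)⁻¹) volume)
    (hθF : Integrable (fun x => θ x * ‖F x‖ ^ 2) volume) {ε₀ J K : ℝ} (hε : |ε| ≤ ε₀)
    (hJ : 0 < J) (hJθ : ∫ x, (θ x)⁻¹ ≤ J) (hK0 : 0 < K)
    (hK : Real.exp (rate A₁ CS t₀ * ∫ t, p t) * (2 * k₁) / t₀ ≤ K) (x : ℝ) :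
    ‖u x‖ ^ 2 + ‖η x‖ ^ 2 ≤ K * (1 + fluxConst A₀ A₁ k₁ Cw CW p) * (|ε| * ∫ t, ‖u t‖ ^ 2)
      + (K * ε₀ * (k₁ / A₀) + K ^ 2 * J) * ∫ t, θ t * ‖F t‖ ^ 2 := by
  have hA₀ := H.A₀_pos
  have hk1 : 0 ≤ k₁ := (H.k_bounds 0).1.trans (H.k_bounds 0).2
  have iη := integrable_norm_sq H.η_memLp
  have iu := integrable_norm_sq H.u_memLp
  have iF := integrable_norm_sq H.F_memLp
  have iuη := integrable_norm_mul_norm H.u_memLp H.η_memLp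
  have iFη := integrable_norm_mul_norm H.F_memLp H.η_memLp
  have hθ0 : ∀ x, 0 < θ x := fun x => one_pos.trans_le (hθ1 x)
  set Q := |ε| * (∫ t, ‖u t‖ * ‖η t‖) + ∫ t, ‖F t‖ * ‖η t‖ with hQ
  have hQ0 : 0 ≤ Q := by positivity
  set M := K * Q with hM
  have hsup : ∀ x, ‖u x‖ ^ 2 + ‖η x‖ ^ 2 ≤ M := fun x =>
    (H.energy_le x).trans (mul_le_mul_of_nonneg_right hK hQ0)
  have hM0 : 0 ≤ M := mul_nonneg hK0.le hQ0
  have h1 : ∫ t, ‖u t‖ * ‖η t‖ ≤ ((∫ t, ‖u t‖ ^ 2) + ∫ t, ‖η t‖ ^ 2) / 2 := by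
    rw [← integral_add iu iη, ← integral_div]
    refine integral_mono iuη ((iu.add iη).div_const _) fun t => ?_
    dsimp only
    linarith [two_mul_le_add_sq ‖u t‖ ‖η t‖]
  -- The Young weight is chosen so that, after multiplication by `K`, the first term is at most `M /
  -- 2`.
  have h2 : ∫ t, ‖F t‖ * ‖η t‖ ≤ 1 / (2 * K * J) * M * (∫ t, (θ t)⁻¹)
      + K * J / 2 * ∫ t, θ t * ‖F t‖ ^ 2 := by
    rw [← integral_const_mul, ← integral_const_mul,
      ← integral_add (hθi.const_mul _) (hθF.const_mul _)]
    refine integral_mono iFη ((hθi.const_mul _).add (hθF.const_mul _)) fun t => ?_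
    have h3 : ‖η t‖ ^ 2 ≤ M := (le_add_of_nonneg_left (sq_nonneg _)).trans (hsup t)
    have h4 : 1 / (2 * K * J) * ‖η t‖ ^ 2 * (θ t)⁻¹ ≤ 1 / (2 * K * J) * M * (θ t)⁻¹ := by
      have := hθ0 t
      gcongr
    have h5 : 1 / (2 * K * J) * ‖η t‖ ^ 2 * (θ t)⁻¹ + K * J / 2 * (θ t * ‖F t‖ ^ 2)
        - ‖F t‖ * ‖η t‖ = (‖η t‖ - K * J * θ t * ‖F t‖) ^ 2 / (2 * K * J * θ t) := by
      have := (hθ0 t).ne'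
      field_simp
      ring
    have h6 : 0 ≤ (‖η t‖ - K * J * θ t * ‖F t‖) ^ 2 / (2 * K * J * θ t) := by
      have := hθ0 t
      positivity
    dsimp only
    linarith
  have h3 : ∫ t, ‖F t‖ ^ 2 ≤ ∫ t, θ t * ‖F t‖ ^ 2 :=
    integral_mono iF hθF fun t => le_mul_of_one_le_left (sq_nonneg _) (hθ1 t)
  have h4 := H.integral_flux_sq_le
  set X := ∫ t, ‖η t‖ ^ 2
  set Y := ∫ t, ‖u t‖ ^ 2
  set Ψ := ∫ t, θ t * ‖F t‖ ^ 2
  have hΨ : 0 ≤ Ψ := (integral_nonneg fun t => sq_nonneg _).trans h3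
  have h5 : 1 / (2 * K * J) * M * (∫ t, (θ t)⁻¹) ≤ 1 / (2 * K * J) * M * J := by gcongr
  have h6 : K * (1 / (2 * K * J) * M * J) = M / 2 := by field_simp
  have h7 : M ≤ K * (|ε| * ((Y + X) / 2)) + M / 2 + K ^ 2 * J / 2 * Ψ := by
    calc M = K * (|ε| * (∫ t, ‖u t‖ * ‖η t‖)) + K * ∫ t, ‖F t‖ * ‖η t‖ := by rw [hM, hQ]; ring
      _ ≤ K * (|ε| * ((Y + X) / 2)) + K * (1 / (2 * K * J) * M * J + K * J / 2 * Ψ) := by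
        gcongr
        linarith
      _ = _ := by rw [mul_add, h6]; ring
  have h8 : |ε| * X ≤ fluxConst A₀ A₁ k₁ Cw CW p * (|ε| * Y) + ε₀ * (k₁ / A₀) * Ψ := by
    calc |ε| * X ≤ |ε| * (fluxConst A₀ A₁ k₁ Cw CW p * Y + k₁ / A₀ * Ψ) := by
          gcongr
          refine h4.trans ?_
          gcongr
      _ = fluxConst A₀ A₁ k₁ Cw CW p * (|ε| * Y) + |ε| * (k₁ / A₀ * Ψ) := by ring
      _ ≤ fluxConst A₀ A₁ k₁ Cw CW p * (|ε| * Y) + ε₀ * (k₁ / A₀ * Ψ) := by gcongr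
      _ = _ := by ring
  have h9 := mul_le_mul_of_nonneg_left h8 hK0.le
  refine (hsup x).trans ?_
  linarith

end IsEnergySystem

/-- A square integrable function with square integrable derivative is bounded. -/
theorem IsPrimitive.exists_norm_le {u du : ℝ → ℂ} (h : IsPrimitive u du) (hu : MemLp u 2 volume)
    (hdu : MemLp du 2 volume) : ∃ C, ∀ x, ‖u x‖ ≤ C := by
  have i1 : Integrable (fun x => ‖du x‖ * ‖u x‖) volume :=
    IsEnergySystem.integrable_norm_mul_norm hdu hu
  refine ⟨√(∫ x, 2 * (‖du x‖ * ‖u x‖)), fun x => Real.le_sqrt_of_sq_le ?_⟩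
  have := h.normSq.gronwall (IsEnergySystem.integrable_norm_sq hu) (p := fun _ => 0)
    (integrable_zero _ _ _) (fun _ => le_rfl) (i1.const_mul 2)
    (Filter.Eventually.of_forall fun t => by positivity)
    (Filter.Eventually.of_forall fun t => by
      have := le_of_abs_le (abs_re_mul_star_le (du t) (u t))
      linarith) x
  simpa using this

/-! ### From the operator to an energy system, uniformly in the energy. -/

namespace Coeffs.Admissible

variable {c : Coeffs}

/-- The effective potentials of energies in a bounded interval have a common variation bound. -/
theorem exists_variationBound_effective (hc : c.Admissible) {Emax : ℝ} (hE : 0 ≤ Emax) :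
    ∃ N CW, 0 ≤ CW ∧ ∀ E, |E| ≤ Emax →
      VariationBound (c.effective E) N ∧ ∀ x, |c.effective E x| ≤ CW := by
  obtain ⟨m, hm, hβm⟩ := hc.β_lower
  obtain ⟨Nβ, hNβ⟩ := hc.β_bv.exists_variationBound
  obtain ⟨Nα, hNα⟩ := hc.α_bv.exists_variationBound
  obtain ⟨NV, hNV⟩ := hc.V₁_bv.exists_variationBound
  obtain ⟨Nb, hNb⟩ := hc.b₁_bv.exists_variationBound
  obtain ⟨L₀, hL₀⟩ := hNβ.inv hm hβm
  obtain ⟨L, hL⟩ := hL₀.mul hNα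
  obtain ⟨L₂, hL₂⟩ := hL.mul hNV
  obtain ⟨L₃, hL₃⟩ := hNb.mul hNb
  have hR := (hL₂.const_mul (-1)).add hL₃
  obtain ⟨C, hC0, hC⟩ := hL.exists_abs_le
  obtain ⟨D, hD0, hD⟩ := hR.exists_abs_le
  have key : ∀ E, c.effective E = fun x => E * ((c.β x)⁻¹ * c.α x)
      + (-1 * ((c.β x)⁻¹ * c.α x * c.V₁ x) + c.b₁ x * c.b₁ x) := by
    intro E; funext x; simp only [Coeffs.effective]; ring
  refine ⟨fun x => Emax * L x + (|(-1)| * L₂ x + L₃ x), Emax * C + D, by positivity, fun E hEm => ?_⟩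
  rw [key E]
  refine ⟨VariationBound.add (hL.of_le hE fun x y => ?_) hR, fun x => ?_⟩
  · rw [← mul_sub, abs_mul]
    gcongr
  · refine (abs_add_le _ _).trans (add_le_add ?_ (hD x))
    rw [abs_mul]
    exact mul_le_mul hEm (hC x) (abs_nonneg _) hE

end Coeffs.Admissible

/-- The regularized flux is square integrable. -/
theorem IsFluxSystem.memLp_flux {c : Coeffs} (hc : c.Admissible) {h : ℝ} {w κ : ℝ → ℝ}
    {f u du η dη : ℝ → ℂ} (H : IsFluxSystem c h w κ f u du η dη) (hw : Measurable w) {Cw : ℝ}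
    (hCw : ∀ x, |w x| ≤ Cw) : MemLp η 2 volume := by
  obtain ⟨Nα, hNα⟩ := hc.α_bv.exists_variationBound
  obtain ⟨Nb, hNb⟩ := hc.b₁_bv.exists_variationBound
  obtain ⟨Cα, -, hCα⟩ := hNα.exists_abs_le
  obtain ⟨Cb, -, hCb⟩ := hNb.exists_abs_le
  obtain ⟨Cu, hCu⟩ := H.prim.exists_norm_le H.memLp H.memLp_deriv
  have hbdd : ∀ {k : ℝ → ℝ} {g : ℝ → ℂ} {C : ℝ}, Measurable k → (∀ x, |k x| ≤ C) →
      MemLp g 2 volume → MemLp (fun x => (k x : ℂ) * g x) 2 volume := by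
    intro k g C hk hC hg
    refine hg.of_le_mul (c := C)
      ((Complex.measurable_ofReal.comp hk).aestronglyMeasurable.mul hg.1)
      (Filter.Eventually.of_forall fun x => ?_)
    rw [norm_mul, Complex.norm_real]
    exact mul_le_mul_of_nonneg_right (hC x) (norm_nonneg _)
  have h1 := (hbdd hNα.measurable hCα H.memLp_deriv).const_mul (h : ℂ)
  have h2 : MemLp (fun x => (c.b₀ x : ℂ) * u x) 2 volume := by
    refine hc.b₀_memLp_two.of_le_mul (c := Cu)
      (hc.b₀_memLp_two.ofReal.1.mul H.memLp.1) (Filter.Eventually.of_forall fun x => ?_)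
    rw [norm_mul, Complex.norm_real, mul_comm]
    exact mul_le_mul_of_nonneg_right (hCu x) (norm_nonneg _)
  have h3 := hbdd hNb.measurable hCb H.memLp
  have h4 := hbdd hw hCw H.memLp
  refine (memLp_congr_ae ?_).1 ((h1.add ((h2.add h3).const_mul Complex.I)).sub h4)
  filter_upwards [H.flux_eq] with x hx
  simp only [Pi.add_apply, Pi.sub_apply]
  have : (c.b x : ℂ) = c.b₀ x + c.b₁ x := by simp [Coeffs.b]
  rw [this] at hx
  linear_combination hx

/-- The functions in the domain solve an energy system whose constants do not depend on the
energy. -/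
theorem exists_isEnergySystem {c : Coeffs} (hc : c.Admissible) {h : ℝ} (hh : 0 < h)
    {Emax : ℝ} (hEmax : 0 ≤ Emax) {t₀ : ℝ} (ht : 0 < t₀) (ht1 : t₀ ≤ 1) (ρ : ℝ) :
    ∃ (A₀ A₁ k₁ Cw CW CS : ℝ) (p A k w : ℝ → ℝ), ∀ E, |E| ≤ Emax →
      (∀ x, ρ < |x| → t₀ ≤ c.effective E x) → ∃ q W S σ b : ℝ → ℝ,
      ∀ v f, IsImage c h v f → ∀ ε : ℝ, ∃ F u du η dη : ℝ → ℂ, v =ᵐ[volume] u ∧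
        (∀ x, F x = f x - (E + Complex.I * ε) * u x) ∧
        (∀ᵐ x, (h : ℂ) * c.α x * du x + Complex.I * c.b x * u x = η x + w x * u x) ∧
        IsEnergySystem A₀ A₁ k₁ Cw CW CS t₀ p A k w q W S σ b ε F u du η dη := by
  obtain ⟨w, κ, p, Cw, hw, hκ, hp, hwp, hκp, hCw, hsys⟩ := exists_isFluxSystem hc hh
  obtain ⟨N, CW, hCW0, hN⟩ := hc.exists_variationBound_effective hEmax
  obtain ⟨mα, hmα, hαm⟩ := hc.α_lower
  obtain ⟨mβ, hmβ, hβm⟩ := hc.β_lower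
  obtain ⟨Nα, hNα⟩ := hc.α_bv.exists_variationBound
  obtain ⟨Nβ, hNβ⟩ := hc.β_bv.exists_variationBound
  obtain ⟨Nb, hNb⟩ := hc.b₁_bv.exists_variationBound
  obtain ⟨Cα, -, hCα⟩ := hNα.exists_abs_le
  obtain ⟨Cb, hCb0, hCb⟩ := hNb.exists_abs_le
  have hα0 : ∀ x, 0 < c.α x := fun x => hmα.trans_le (hαm x)
  have hβ0 : ∀ x, 0 < c.β x := fun x => hmβ.trans_le (hβm x)
  have hCα' : ∀ x, c.α x ≤ Cα := fun x => (le_abs_self _).trans (hCα x)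
  have hCα0 : 0 < Cα := (hα0 0).trans_le (hCα' 0)
  have hCw0 : 0 ≤ Cw := (abs_nonneg _).trans (hCw 0)
  have hp0 : ∀ x, 0 ≤ p x := fun x => (abs_nonneg _).trans (hwp x)
  have hN0 := hN 0 (by simpa using hEmax)
  set A₁ := (h * mα)⁻¹ with hA₁
  have hA₁0 : 0 < A₁ := by positivity
  -- This pays for truncating the effective potential at `t₀`: the two differ only on `[-ρ, ρ]`, by
  -- at most `CW + 1` since `t₀ ≤ 1`.
  set ι : ℝ → ℝ := (Icc (-ρ) ρ).indicator fun _ => CW + 1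
  have hι : Integrable ι volume :=
    continuous_const.integrableOn_Icc.integrable_indicator measurableSet_Icc
  have hι0 : ∀ x, 0 ≤ ι x := fun x => indicator_nonneg (fun _ _ => by positivity) x
  -- This dominates `A(b₁² - b² - w²)`. Integrability uses both `b₀ ∈ L¹` and `b₀ ∈ L²`.
  set r : ℝ → ℝ := fun x => A₁ * (2 * Cb * |c.b₀ x| + c.b₀ x ^ 2 + Cw * p x)
  have hr : Integrable r volume :=
    ((((memLp_one_iff_integrable.1 hc.b₀_memLp_one).abs.const_mul _).add
      hc.b₀_memLp_two.integrable_sq).add (hp.const_mul _)).const_mul _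
  have hr0 : ∀ x, 0 ≤ r x := fun x => by
    have := hp0 x
    positivity
  set P : ℝ → ℝ := fun x => p x + r x + (N (x + 1) - N x) + ι x
  have hP : Integrable P volume := ((hp.add hr).add hN0.1.integrable_increment).add hι
  refine ⟨(h * Cα)⁻¹, A₁, (h * mβ)⁻¹, Cw, CW, CW + 1, P, fun x => (h * c.α x)⁻¹,
    fun x => (h * c.β x)⁻¹, w, fun E hE hlow => ?_⟩
  obtain ⟨hV, hVb⟩ := hN E hE
  have hM := hV.max_const t₀
  have hMb : ∀ x, |max (c.effective E x) t₀| ≤ CW + 1 := fun x => by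
    have h1 := abs_le.1 (hVb x)
    rw [abs_of_nonneg (ht.le.trans (le_max_right _ _))]
    exact max_le (by linarith) (by linarith)
  have hA0 : ∀ x, 0 < (h * c.α x)⁻¹ := fun x => inv_pos.2 (mul_pos hh (hα0 x))
  have hA1 : ∀ x, (h * c.α x)⁻¹ ≤ A₁ := fun x => by
    rw [hA₁]
    gcongr
    exact hαm x
  -- Substituting `du` into the flux equation produces `-A(b² + w²)u`, while the `bw` terms cancel.
  -- Only `b₁²` is put into `W`, which must have bounded variation, and the rest goes into `q`.
  refine ⟨fun x => (h * c.α x)⁻¹ * (c.b₁ x ^ 2 - c.b x ^ 2 - w x ^ 2) + κ x, c.effective E,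
    average fun x => max (c.effective E x) t₀,
    fun x => max (c.effective E (x + 1)) t₀ - max (c.effective E x) t₀, c.b,
    fun v f hvf ε => ?_⟩
  obtain ⟨u, du, η, dη, hvu, H⟩ := hsys v f hvf
  refine ⟨fun x => f x - (E + Complex.I * ε) * u x, u, du, η, dη, hvu, fun _ => rfl,
    H.flux_eq, ?_⟩
  have hduq : ∀ᵐ x, du x = ((h * c.α x)⁻¹ : ℝ) *
      (η x + w x * u x - Complex.I * c.b x * u x) := by
    filter_upwards [H.flux_eq] with x hx
    have h1 : (h : ℂ) ≠ 0 := by exact_mod_cast hh.ne'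
    have h2 : (c.α x : ℂ) ≠ 0 := by exact_mod_cast (hα0 x).ne'
    rw [← hx]
    push_cast
    field_simp
    ring
  exact
  { A₀_pos := by positivity
    t₀_pos := ht
    t₀_le := ht1
    A_bounds := fun x => ⟨by
      have := hα0 x
      have := hCα' x
      gcongr, hA1 x⟩
    k_bounds := fun x => ⟨(inv_pos.2 (mul_pos hh (hβ0 x))).le, by
      gcongr
      exact hβm x⟩
    W_bound := hVb
    S_bounds := fun x => ⟨hM.le_average (fun y => le_max_right _ _) x,
      (le_abs_self _).trans (VariationBound.abs_average_le hMb x)⟩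
    w_bound := hCw
    w_le := fun x => by
      have := hwp x
      have := hr0 x
      have := hN0.1.increment_nonneg x
      have := hι0 x
      simp only [P]
      linarith
    q_le := fun x => by
      have h1 := hκp x
      have h2 := hN0.1.increment_nonneg x
      have h3 := hι0 x
      have h4 : |(h * c.α x)⁻¹ * (c.b₁ x ^ 2 - c.b x ^ 2 - w x ^ 2)| ≤ r x := by
        rw [abs_mul, abs_of_pos (hA0 x)]
        refine mul_le_mul (hA1 x) ?_ (abs_nonneg _) hA₁0.le
        have e : c.b₁ x ^ 2 - c.b x ^ 2 - w x ^ 2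
            = -(2 * c.b₁ x * c.b₀ x) - c.b₀ x ^ 2 - w x ^ 2 := by
          simp only [Coeffs.b]; ring
        rw [e]
        have h5 : |2 * c.b₁ x * c.b₀ x| ≤ 2 * Cb * |c.b₀ x| := by
          rw [abs_mul, abs_mul, abs_two]
          gcongr
          exact hCb x
        have h6 : w x ^ 2 ≤ Cw * p x := by
          rw [← sq_abs, sq]
          exact mul_le_mul (hCw x) (hwp x) (abs_nonneg _) hCw0
        rw [abs_le] at h5 ⊢
        constructor <;> nlinarith [sq_nonneg (c.b₀ x), sq_nonneg (w x), h5.1, h5.2]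
      refine (abs_add_le _ _).trans ?_
      simp only [P]
      linarith
    σ_le := fun x => by
      have := hM.abs_sub_le x (x + 1) (by linarith)
      have := hp0 x
      have := hr0 x
      have := hι0 x
      simp only [P]
      linarith
    S_sub_le := fun x => by
      have h1 := hM.abs_average_sub_le x
      have h2 : |max (c.effective E x) t₀ - c.effective E x| ≤ ι x := by
        by_cases hx : x ∈ Icc (-ρ) ρ
        · simp only [ι, indicator_of_mem hx]
          have h3 := abs_le.1 (hVb x)
          rw [abs_of_nonneg (sub_nonneg.2 (le_max_left _ _)), sub_le_iff_le_add]
          exact max_le (by linarith) (by linarith)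
        · rw [max_eq_left (hlow x (by
            by_contra hx'
            exact hx (abs_le.1 (not_lt.1 hx')))), sub_self, abs_zero]
          exact hι0 x
      have := hp0 x
      have := hr0 x
      have h4 := abs_sub_le (average (fun x => max (c.effective E x) t₀) x)
        (max (c.effective E x) t₀) (c.effective E x)
      simp only [P]
      linarith
    p_int := hP
    A_meas := (hNα.measurable.const_mul h).inv.aestronglyMeasurable
    k_meas := (hNβ.measurable.const_mul h).inv.aestronglyMeasurable
    q_meas := by
      refine ((hNα.measurable.const_mul h).inv.aestronglyMeasurable.mul
        (((hNb.measurable.pow_const 2).aestronglyMeasurable.sub ?_).sub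
          (hw.pow_const 2).aestronglyMeasurable)).add hκ.aestronglyMeasurable
      exact (hc.b₀_memLp_one.1.add hNb.measurable.aestronglyMeasurable).pow 2
    W_meas := hV.measurable.aestronglyMeasurable
    S_prim := hM.isPrimitive_average
    u_prim := H.prim
    η_prim := H.prim_flux
    F_memLp := H.memLp_image.sub (H.memLp.const_mul _)
    u_memLp := H.memLp
    η_memLp := H.memLp_flux hc hw hCw
    du_memLp := H.memLp_deriv
    du_eq := hduq
    dη_eq := by
      filter_upwards [hduq, H.deriv_flux_eq] with x hx1 hx2
      have h1 : (h : ℂ) ≠ 0 := by exact_mod_cast hh.ne'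
      have h2 : (c.α x : ℂ) ≠ 0 := by exact_mod_cast (hα0 x).ne'
      have h3 : (c.β x : ℂ) ≠ 0 := by exact_mod_cast (hβ0 x).ne'
      rw [hx2, hx1]
      simp only [Coeffs.effective]
      push_cast
      field_simp
      ring_nf
      simp only [Complex.I_sq]
      ring }

/-! ### Bounds for the phase. -/

namespace IsPhase

variable {R₁ k : ℝ} {φ : ℝ → ℝ}

theorem deriv_neg (H : IsPhase R₁ k φ) (x : ℝ) : deriv φ (-x) = -deriv φ x := by
  have h1 := deriv_comp_neg φ x
  rw [funext H.even] at h1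
  linarith

theorem deriv_eq_zero (H : IsPhase R₁ k φ) {x : ℝ} (hx : 2 * R₁ < |x|) : deriv φ x = 0 := by
  rcases lt_abs.1 hx with h | h
  · exact H.deriv_outer x h
  · have := H.deriv_neg x
    rw [H.deriv_outer _ h] at this
    linarith

theorem exists_abs_deriv_le (H : IsPhase R₁ k φ) (hR : 0 ≤ R₁) :
    ∃ K, 0 ≤ K ∧ ∀ x ≠ 0, |deriv φ x| ≤ K := by
  have key : ∃ K, 0 ≤ K ∧ ∀ x, 0 < x → |deriv φ x| ≤ K := by
    rcases hR.eq_or_lt with h0 | h0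
    · refine ⟨0, le_rfl, fun x hx => ?_⟩
      rw [H.deriv_outer x (by linarith), abs_zero]
    · have h1 : ContinuousOn (deriv φ) (Icc R₁ (2 * R₁)) :=
        (H.smooth.continuousOn_deriv_of_isOpen isOpen_Ioi (by simp)).mono
          fun x hx => h0.trans_le hx.1
      obtain ⟨B, hB⟩ := isCompact_Icc.exists_bound_of_continuousOn h1
      refine ⟨max |k| B, (abs_nonneg _).trans (le_max_left _ _), fun x hx => ?_⟩
      rcases le_or_gt x R₁ with h2 | h2
      · rw [H.deriv_inner x hx h2]; exact le_max_left _ _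
      · rcases le_or_gt x (2 * R₁) with h3 | h3
        · exact (hB x ⟨h2.le, h3⟩).trans (le_max_right _ _)
        · rw [H.deriv_outer x h3, abs_zero]
          exact (abs_nonneg _).trans (le_max_left _ _)
  obtain ⟨K, hK0, hK⟩ := key
  refine ⟨K, hK0, fun x hx => ?_⟩
  rcases lt_or_gt_of_ne hx with h | h
  · have := hK (-x) (neg_pos.2 h)
    rwa [H.deriv_neg, abs_neg] at this
  · exact hK x h

theorem hasDerivAt (H : IsPhase R₁ k φ) {x : ℝ} (hx : x ≠ 0) : HasDerivAt φ (deriv φ x) x := by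
  have key : ∀ y, 0 < y → DifferentiableAt ℝ φ y := fun y hy =>
    (H.smooth.contDiffAt (Ioi_mem_nhds hy)).differentiableAt (by simp)
  refine DifferentiableAt.hasDerivAt ?_
  rcases lt_or_gt_of_ne hx with h | h
  · rw [← funext H.even]
    exact (key (-x) (neg_pos.2 h)).comp x differentiableAt_id.neg
  · exact key x h

theorem integrable_deriv (H : IsPhase R₁ k φ) (hR : 0 ≤ R₁) : Integrable (deriv φ) volume := by
  obtain ⟨K, hK0, hK⟩ := H.exists_abs_deriv_le hR
  have h1 : Integrable ((Icc (-(2 * R₁)) (2 * R₁)).indicator fun _ => K) volume :=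
    continuous_const.integrableOn_Icc.integrable_indicator measurableSet_Icc
  refine h1.mono' (measurable_deriv φ).aestronglyMeasurable ?_
  filter_upwards [compl_mem_ae_iff.2 (measure_singleton (μ := volume) (0 : ℝ))] with x hx
  by_cases h2 : x ∈ Icc (-(2 * R₁)) (2 * R₁)
  · rw [indicator_of_mem h2]; exact hK x hx
  · rw [indicator_of_notMem h2, H.deriv_eq_zero, norm_zero]
    by_contra h3
    exact h2 (abs_le.1 (not_lt.1 h3))

theorem isPrimitive (H : IsPhase R₁ k φ) (hR : 0 ≤ R₁) : IsPrimitive φ (deriv φ) :=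
  IsPrimitive.of_hasDerivAt_off_countable (countable_singleton 0) H.continuous
    (fun _ hx => H.hasDerivAt hx) (H.integrable_deriv hR).locallyIntegrable

/-- The derivative is bounded with compact support, and the possible corner at 0 does no harm to the
fundamental theorem of calculus. -/
theorem exists_le (H : IsPhase R₁ k φ) (hR : 0 ≤ R₁) : ∃ B, ∀ x, φ x ≤ B := by
  refine ⟨∫ x, ‖deriv φ x‖, fun x => ?_⟩
  have h1 := (H.isPrimitive hR).sub_eq 0 x
  rw [H.zero, sub_zero] at h1
  rw [h1]
  exact (Real.le_norm_self _).trans (intervalIntegral.norm_integral_le_integral_norm_uIoc.trans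
    (setIntegral_le_integral (H.integrable_deriv hR).norm
      (Filter.Eventually.of_forall fun _ => norm_nonneg _)))

theorem isPrimitive_exp (H : IsPhase R₁ k φ) (hR : 0 ≤ R₁) (h : ℝ) :
    IsPrimitive (fun x => ((Real.exp (φ x / h) : ℝ) : ℂ))
      (fun x => ((Real.exp (φ x / h) * (deriv φ x / h) : ℝ) : ℂ)) := by
  have hc : Continuous fun x => Real.exp (φ x / h) :=
    Real.continuous_exp.comp (H.continuous.div_const h)
  refine IsPrimitive.clm Complex.ofRealCLM
    (IsPrimitive.of_hasDerivAt_off_countable (countable_singleton 0) hc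
      (fun x hx => ((H.hasDerivAt hx).div_const h).exp) ?_)
  exact ((H.integrable_deriv hR).div_const h).locallyIntegrable.continuous_mul hc

end IsPhase

/-! ### The weighted estimate. -/

theorem one_le_bracket (x : ℝ) : 1 ≤ bracket x :=
  Real.one_le_rpow (by simpa using sq_nonneg |x|) (by norm_num)

theorem integrable_bracket_rpow_neg {s : ℝ} (hs : 1 / 2 < s) :
    Integrable (fun x => bracket x ^ (-2 * s)) volume := by
  have := integrable_rpow_neg_one_add_norm_sq (E := ℝ) (μ := volume) (r := 2 * s)
    (by simp; linarith)
  convert! this using 1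
  funext x
  rw [bracket, ← Real.rpow_mul (by positivity), Real.norm_eq_abs]
  ring_nf

/-- The pointwise bound for the energy density of the conjugated function. -/
theorem norm_sq_conjugated_add_le {X D e γ : ℝ} {u η ζ : ℂ} (he0 : 0 ≤ e) (he : e ≤ X)
    (hγ : |γ| ≤ D) (hζ : ζ = e * (η + γ * u)) :
    ‖(e : ℂ) * u‖ ^ 2 + ‖ζ‖ ^ 2 ≤ X ^ 2 * (3 + 2 * D ^ 2) * (‖u‖ ^ 2 + ‖η‖ ^ 2) := by
  have h1 : ‖η + γ * u‖ ≤ ‖η‖ + D * ‖u‖ := by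
    refine (norm_add_le _ _).trans ?_
    rw [norm_mul, Complex.norm_real]
    gcongr
    exact hγ
  have h2 : ‖η + γ * u‖ ^ 2 ≤ 2 * ‖η‖ ^ 2 + 2 * D ^ 2 * ‖u‖ ^ 2 := by
    refine (pow_le_pow_left₀ (norm_nonneg _) h1 2).trans ?_
    nlinarith [sq_nonneg (‖η‖ - D * ‖u‖)]
  rw [hζ, norm_mul, norm_mul, Complex.norm_real, Real.norm_of_nonneg he0, mul_pow, mul_pow,
    ← mul_add]
  have h3 : e ^ 2 ≤ X ^ 2 := pow_le_pow_left₀ he0 he 2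
  calc e ^ 2 * (‖u‖ ^ 2 + ‖η + γ * u‖ ^ 2)
      ≤ X ^ 2 * ((3 + 2 * D ^ 2) * (‖u‖ ^ 2 + ‖η‖ ^ 2)) := by
        refine mul_le_mul h3 ?_ (by positivity) (by positivity)
        nlinarith [sq_nonneg ‖u‖, sq_nonneg ‖η‖, mul_nonneg (sq_nonneg D) (sq_nonneg ‖η‖)]
    _ = _ := by ring

/-- The weighted estimate at a fixed value of the semiclassical parameter. -/
theorem exists_energyDensity_le {s Emax ε₀ : ℝ} (hs : 1 / 2 < s) (hEmax : 0 ≤ Emax) {c : Coeffs}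
    (hc : c.Admissible) {h : ℝ} (hh : 0 < h) {R₁ k τ : ℝ} {φ : ℝ → ℝ} (hR : 0 ≤ R₁) (hτ : 0 < τ)
    (hφ : IsPhase R₁ k φ) :
    ∃ C, 0 < C ∧ ∀ E ∈ Icc (-Emax) Emax, ∀ ε ∈ Icc (-ε₀) ε₀,
      (∀ x, x ≠ 0 → τ ≤ c.effective E x + c.α x ^ 2 * (deriv φ x) ^ 2) →
      ∀ v f, IsImage c h v f →
        MemLp (fun x => ((bracket x ^ s : ℝ) : ℂ) * (f x - (E + Complex.I * ε) * v x)) 2 volume →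
        ∃ du : ℝ → ℂ, HasWeakDeriv (conjugated φ h v) du ∧
          Integrable (energyDensity c h s (conjugated φ h v) du) volume ∧
          ∫ x, energyDensity c h s (conjugated φ h v) du x ≤
            C * (∫ x, bracket x ^ (2 * s) * ‖f x - (E + Complex.I * ε) * v x‖ ^ 2)
              + |ε| * C * ∫ x, ‖v x‖ ^ 2 := by
  have ht : 0 < min τ 1 := lt_min hτ one_pos
  obtain ⟨A₀, A₁, k₁, Cw, CW, CS, p, A, w₀, w, hsys⟩ :=
    exists_isEnergySystem hc hh hEmax ht (min_le_right _ _) (2 * R₁)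
  obtain ⟨B, hB⟩ := hφ.exists_le hR
  obtain ⟨Kφ, hKφ0, hKφ⟩ := hφ.exists_abs_deriv_le hR
  obtain ⟨Nα, hNα⟩ := hc.α_bv.exists_variationBound
  obtain ⟨Nb, hNb⟩ := hc.b₁_bv.exists_variationBound
  obtain ⟨Cα, hCα0, hCα⟩ := hNα.exists_abs_le
  have hJi := integrable_bracket_rpow_neg hs
  have hbr0 : ∀ x, 0 < bracket x := fun x => one_pos.trans_le (one_le_bracket x)
  set J := (∫ x, bracket x ^ (-2 * s)) + 1 with hJ
  have hJ0 : 0 < J := add_pos_of_nonneg_of_pos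
    (integral_nonneg fun x => Real.rpow_nonneg (hbr0 x).le _) one_pos
  -- The signs of `A₀` and `k₁` are known only once an energy system is at hand, whereas the
  -- constant must be chosen before. Hence the absolute values here and in the final constant.
  set K := |Real.exp (IsEnergySystem.rate A₁ CS (min τ 1) * ∫ t, p t) * (2 * k₁) / min τ 1| + 1
    with hK
  have hK0 : 0 < K := by positivity
  set a := K * (1 + IsEnergySystem.fluxConst A₀ A₁ k₁ Cw CW p) with ha
  set a' := K * ε₀ * (k₁ / A₀) + K ^ 2 * J with ha'
  set D := Cw + Cα * Kφ with hD
  set Γ := Real.exp (B / h) ^ 2 * (3 + 2 * D ^ 2) with hΓ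
  have hΓ0 : 0 < Γ := by positivity
  refine ⟨Γ * J * (|a| + |a'| + 1), by positivity, fun E hE ε hε hlow v f hvf hmem => ?_⟩
  obtain ⟨q, W, S, σ, b, hsol⟩ := hsys E (abs_le.2 hE) fun x hx => by
    have hx0 : x ≠ 0 := by
      rintro rfl
      rw [abs_zero] at hx
      linarith
    have := hlow x hx0
    rw [hφ.deriv_eq_zero hx] at this
    exact (min_le_left _ _).trans (by simpa using this)
  obtain ⟨F, u, du, η, dη, hvu, hF, hflux, H⟩ := hsol v f hvf ε
  have hFv : ∀ᵐ x, bracket x ^ (2 * s) * ‖f x - (E + Complex.I * ε) * v x‖ ^ 2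
      = bracket x ^ (2 * s) * ‖F x‖ ^ 2 := by
    filter_upwards [hvu] with x hx
    rw [hF, hx]
  have hθF : Integrable (fun x => bracket x ^ (2 * s) * ‖F x‖ ^ 2) volume := by
    refine (IsEnergySystem.integrable_norm_sq hmem).congr ?_
    filter_upwards [hFv] with x hx
    rw [← hx, norm_mul, Complex.norm_real, Real.norm_of_nonneg (Real.rpow_nonneg (hbr0 x).le _),
      mul_pow, ← Real.rpow_natCast, ← Real.rpow_mul (hbr0 x).le]
    norm_num [mul_comm]
  have hinv : (fun x => (bracket x ^ (2 * s))⁻¹) = fun x => bracket x ^ (-2 * s) := by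
    funext x
    rw [neg_mul, Real.rpow_neg (hbr0 x).le]
  have hsup := H.energy_le_weighted (θ := fun x => bracket x ^ (2 * s)) (ε₀ := ε₀) (J := J)
    (K := K) (fun x => Real.one_le_rpow (one_le_bracket x) (by linarith)) (by rwa [hinv]) hθF
    (abs_le.2 hε) hJ0 (by rw [hinv, hJ]; linarith) hK0
    ((le_abs_self _).trans (le_add_of_nonneg_right zero_le_one))
  rw [← ha, ← ha'] at hsup
  set Y := ∫ t, ‖u t‖ ^ 2 with hY
  set Ψ := ∫ t, bracket t ^ (2 * s) * ‖F t‖ ^ 2 with hΨ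
  have hY0 : 0 ≤ Y := integral_nonneg fun t => sq_nonneg _
  have hΨ0 : 0 ≤ Ψ := integral_nonneg fun t =>
    mul_nonneg (Real.rpow_nonneg (hbr0 t).le _) (sq_nonneg _)
  have hYv : ∫ x, ‖v x‖ ^ 2 = Y := integral_congr_ae (by
    filter_upwards [hvu] with x hx
    rw [hx])
  set M := |a| * (|ε| * Y) + |a'| * Ψ with hM
  have hsup' : ∀ x, ‖u x‖ ^ 2 + ‖η x‖ ^ 2 ≤ M := fun x => by
    refine (hsup x).trans ?_
    rw [hM]
    gcongr <;> exact le_abs_self _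
  have hM0 : 0 ≤ M := by positivity
  have hprim := (hφ.isPrimitive_exp hR h).mul H.u_prim
  have hconj : conjugated φ h v =ᵐ[volume] fun x => ((Real.exp (φ x / h) : ℝ) : ℂ) * u x := by
    filter_upwards [hvu] with x hx
    simp only [conjugated, hx]
  set dU : ℝ → ℂ := fun x => ((Real.exp (φ x / h) * (deriv φ x / h) : ℝ) : ℂ) * u x
    + ((Real.exp (φ x / h) : ℝ) : ℂ) * du x
  have hle : ∀ᵐ x, energyDensity c h s (conjugated φ h v) dU x
      ≤ Γ * M * bracket x ^ (-2 * s) := by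
    filter_upwards [hconj, hflux, compl_mem_ae_iff.2 (measure_singleton (μ := volume) (0 : ℝ))]
      with x hx1 hx2 hx0
    have h1 : (h : ℂ) ≠ 0 := by exact_mod_cast hh.ne'
    -- Conjugation gives `(hα∂ + ib)(e^{φ/h}u) = e^{φ/h}(η + (w + αφ')u)`, which holds almost
    -- everywhere; the origin is excluded because `φ'` is bounded only off 0.
    have hγ : |w x + c.α x * deriv φ x| ≤ D := by
      refine (abs_add_le _ _).trans (add_le_add (H.w_bound x) ?_)
      rw [abs_mul]
      exact mul_le_mul (hCα x) (hKφ x hx0) (abs_nonneg _) hCα0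
    have key := norm_sq_conjugated_add_le (X := Real.exp (B / h)) (e := Real.exp (φ x / h))
      (u := u x) (η := η x)
      (ζ := (h : ℂ) * c.α x * dU x + Complex.I * c.b x * (((Real.exp (φ x / h) : ℝ) : ℂ) * u x))
      (Real.exp_pos _).le (Real.exp_le_exp.2 (by gcongr; exact hB x)) hγ (by
        simp only [dU]
        push_cast
        field_simp
        linear_combination hx2)
    rw [energyDensity, hx1, mul_comm]
    have h2 : 0 ≤ bracket x ^ (-2 * s) := Real.rpow_nonneg (hbr0 x).le _
    refine mul_le_mul_of_nonneg_right (key.trans ?_) h2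
    exact mul_le_mul_of_nonneg_left (hsup' x) hΓ0.le
  have hmeas : AEStronglyMeasurable (energyDensity c h s (conjugated φ h v) dU) volume := by
    have m1 : AEStronglyMeasurable (conjugated φ h v) volume :=
      hprim.continuous.aestronglyMeasurable.congr hconj.symm
    have m2 : AEStronglyMeasurable dU volume := hprim.locallyIntegrable.aestronglyMeasurable
    have m3 : AEStronglyMeasurable (fun x => (c.α x : ℂ)) volume :=
      (Complex.measurable_ofReal.comp hNα.measurable).aestronglyMeasurable
    have m4 : AEStronglyMeasurable (fun x => (c.b x : ℂ)) volume :=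
      Complex.continuous_ofReal.comp_aestronglyMeasurable
        (hc.b₀_memLp_one.1.add hNb.measurable.aestronglyMeasurable)
    have m5 : AEStronglyMeasurable (fun x => bracket x ^ (-2 * s)) volume := hJi.1
    exact m5.mul ((m1.norm.pow 2).add
      ((((m3.const_mul (h : ℂ)).mul m2).add ((m4.const_mul Complex.I).mul m1)).norm.pow 2))
  have hint : Integrable (energyDensity c h s (conjugated φ h v) dU) volume := by
    refine (hJi.const_mul (Γ * M)).mono' hmeas ?_
    filter_upwards [hle] with x hx
    rwa [Real.norm_of_nonneg]
    exact mul_nonneg (Real.rpow_nonneg (hbr0 x).le _) (by positivity)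
  refine ⟨dU, hprim.hasWeakDeriv hconj, hint, ?_⟩
  rw [integral_congr_ae hFv, hYv]
  refine (integral_mono_ae hint (hJi.const_mul _) hle).trans ?_
  rw [integral_const_mul]
  calc Γ * M * (∫ x, bracket x ^ (-2 * s)) ≤ Γ * M * J := by gcongr; linarith
    _ = Γ * J * |a'| * Ψ + Γ * J * |a| * (|ε| * Y) := by rw [hM]; ring
    _ ≤ Γ * J * (|a| + |a'| + 1) * Ψ + Γ * J * (|a| + |a'| + 1) * (|ε| * Y) := by
      gcongr <;> linarith [abs_nonneg a, abs_nonneg a']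
    _ = _ := by ring

end MagSchrodinger
end

theorem theorem1
    (s Emax h₀ ε₀ : ℝ) (hs : 1 / 2 < s) (hEmax : 0 < Emax) (hh₀ : 0 < h₀) (hε₀ : 0 < ε₀)
    (c : ℝ → MagSchrodinger.Coeffs) (hc : ∀ h ∈ Set.Ioc 0 h₀, (c h).Admissible)
    (R₁ k τ : ℝ → ℝ) (φ : ℝ → ℝ → ℝ)
    (hR₁ : ∀ h ∈ Set.Ioc 0 h₀, 0 ≤ R₁ h) (hk : ∀ h ∈ Set.Ioc 0 h₀, 0 ≤ k h)
    (hτ : ∀ h ∈ Set.Ioc 0 h₀, 0 < τ h)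
    (hφ : ∀ h ∈ Set.Ioc 0 h₀, MagSchrodinger.IsPhase (R₁ h) (k h) (φ h)) :
    ∃ C : ℝ → ℝ, ∀ h ∈ Set.Ioc 0 h₀, 0 < C h ∧
      ∀ E ∈ Set.Icc (-Emax) Emax, ∀ ε ∈ Set.Icc (-ε₀) ε₀,
        (∃ δ : ℝ, 0 < δ ∧ ∀ x : ℝ, R₁ h ≤ |x| → δ ≤ (c h).effective E x) →
        (∀ x : ℝ, x ≠ 0 →
          τ h ≤ (c h).effective E x + (c h).α x ^ 2 * (deriv (φ h) x) ^ 2) →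
        ∀ v : MagSchrodinger.domain (c h) h,
          MeasureTheory.MemLp (fun x => ((MagSchrodinger.bracket x ^ s : ℝ) : ℂ) *
            (MagSchrodinger.op (c h) h v x - (E + Complex.I * ε) * v.1 x)) 2
            MeasureTheory.volume →
          ∃ du : ℝ → ℂ,
            MagSchrodinger.HasWeakDeriv (MagSchrodinger.conjugated (φ h) h v.1) du ∧
            MeasureTheory.Integrable (MagSchrodinger.energyDensity (c h) h s
              (MagSchrodinger.conjugated (φ h) h v.1) du) MeasureTheory.volume ∧
            ∫ x, MagSchrodinger.energyDensity (c h) h s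
                (MagSchrodinger.conjugated (φ h) h v.1) du x ≤
              C h * (∫ x, MagSchrodinger.bracket x ^ (2 * s) *
                ‖MagSchrodinger.op (c h) h v x - (E + Complex.I * ε) * v.1 x‖ ^ 2)
              + |ε| * C h * ∫ x, ‖v.1 x‖ ^ 2 := by
  -- The constant is chosen separately for each `h`, with a dummy value outside `(0, h₀]`.
  have key : ∀ h, ∃ C : ℝ, h ∈ Set.Ioc 0 h₀ → _ := fun h => by
    by_cases hh : h ∈ Set.Ioc 0 h₀
    · obtain ⟨C, hC⟩ := MagSchrodinger.exists_energyDensity_le (ε₀ := ε₀) hs hEmax.le (hc h hh)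
        hh.1 (hR₁ h hh) (hτ h hh) (hφ h hh)
      exact ⟨C, fun _ => hC⟩
    · exact ⟨0, fun h' => absurd h' hh⟩
  choose C hC using key
  refine ⟨C, fun h hh => ⟨(hC h hh).1, fun E hE ε hε _ hlow v hv => ?_⟩⟩
  exact (hC h hh).2 E hE ε hε hlow v.1 _ (MagSchrodinger.op_spec (c h) h v) hv
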